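/- Let $d\ge 1$, let $Q$ be a real symmetric nonnegative definite $d\times d$ matrix and $B$ a real $d\times d$ matrix. For $t>0$ put $Q_t=\int_0^t e^{sB}Qe^{sB^*}\,ds$ and assume $\det Q_t>0$ for all $t>0$. Assume that $B$ is diagonalizable with real, strictly negative eigenvalues: $MBM^{-1}=-\mathrm{diag}(\lambda_1,\dots,\lambda_d)$ with $\lambda_j>0$ for all $j$ and $M$ a real invertible matrix. Put $Q_\infty=\int_0^\infty e^{sB}Qe^{sB^*}\,ds$. Let $P=(P_t)_{t\ge0}$ be the (diffusion) Ornstein-Uhlenbeck semigroup on $\mathbb R^d$ with generator $\frac12\mathrm{tr}(Q\nabla^2)+\langle Bx,\nabla\rangle$, that is, $P_tf(x)=\int f\,d\mathcal N(e^{tB}x,Q_t)$, where $\mathcal N(a,S)$ is the Gaussian measure with mean $a$ and covariance matrix $S$. Let $\mu$ be its invariant distribution; it has a smooth, everywhere positive Lebesgue density, also denoted by $\mu$. For every $t>0$ let $p_t(x,y)$ be the transition density of $P_t$ relative to $\mu$, i.e. the (existing) function, continuous in $y$, with $$P_tf(x)=\int_{\mathbb R^d}f(y)\,p_t(x,y)\,\mu(y)\,dy\qquad\text{for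 all bounded measurable } f \text{ and all } x\in\mathbb R^d.$$ Let $\varrho$ be the smallest eigenvalue of $\lambda_{\min}MQ_\infty M^*$, where $\lambda_{\min}=\min_j\lambda_j$, let $D=\mathrm{diag}(\sqrt{\lambda_1/\varrho},\dots,\sqrt{\lambda_d/\varrho})$, and for $n\in\mathbb N_0^d$ write $|n|=\sum_j n_j$, $n!=\prod_j n_j!$, $z^n=\prod_j z_j^{n_j}$, $\langle n,\lambda\rangle=\sum_j n_j\lambda_j$. Let $\mathcal H_n$ be the polynomials (eigenfunctions of $P_t$) defined by $$\sum_{n\in\mathbb N_0^d}\mathcal H_n(x)\frac{z^n}{\sqrt{n!}}=\exp\Big(\langle Mx,Dz\rangle-\tfrac12\langle Q_\infty M^*Dz,M^*Dz\rangle\Big),$$ i.e. $\mathcal H_n(x)=(n!)^{-1/2}\,\partial_z^n\big|_{z=0}$ of the right-hand side, and let $\mathcal G_n$ be the co-eigenfunctions $$\mathcal G_n(y)=\frac{(-1)^{|n|}}{\sqrt{n!}}\,\frac{\partial_{v_1}^{n_1}\cdots\partial_{v_d}^{n_d}\mu(y)}{\mu(y)},\qquad v_j=(DM)^{-1}e_j,$$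 where $\partial_v$ is the directional derivative along $v$ and $e_1,\dots,e_d$ is the standard basis of $\mathbb R^d$. Then there exists $t_0>0$ such that for all $t>t_0$ and all $(x,y)\in\mathbb R^d\times\mathbb R^d$ the following series converges absolutely and $$p_t(x,y)=\sum_{n\in\mathbb N_0^d}e^{-t\langle n,\lambda\rangle}\,\mathcal H_n(x)\,\mathcal G_n(y).$$ -/

import Mathlib

open MeasureTheory ProbabilityTheory
open scoped Matrix ContDiff

noncomputable section

namespace OU

/-- `ℝ^d` with its Euclidean structure. -/
abbrev E (d : ℕ) := EuclideanSpace ℝ (Fin d)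

variable {d : ℕ}

/-- `Q_t = ∫_0^t e^{sB} Q e^{sB^*} ds`, entry by entry. -/
def covMat (Q B : Matrix (Fin d) (Fin d) ℝ) (t : ℝ) : Matrix (Fin d) (Fin d) ℝ :=
  Matrix.of fun i j =>
    ∫ s in (0 : ℝ)..t, (NormedSpace.exp (s • B) * Q * NormedSpace.exp (s • Bᵀ)) i j

/-- `Q_∞ = ∫_0^∞ e^{sB} Q e^{sB^*} ds`, entry by entry. -/
def covMatInf (Q B : Matrix (Fin d) (Fin d) ℝ) : Matrix (Fin d) (Fin d) ℝ :=
  Matrix.of fun i j =>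
    ∫ s in Set.Ioi (0 : ℝ), (NormedSpace.exp (s • B) * Q * NormedSpace.exp (s • Bᵀ)) i j

/-- The law at time `t`, started at `x`, of the solution of `dX = B X dt + Q^{1/2} dW`
(the process with generator `½ tr(Q ∇²) + ⟨Bx, ∇⟩`): the Gaussian measure with mean `e^{tB} x` and
covariance matrix `Q_t`, i.e. with characteristic function
`ξ ↦ exp(i ⟨e^{tB^*} ξ, x⟩ - ½ ⟨Q_t ξ, ξ⟩)`. -/
def law (Q B : Matrix (Fin d) (Fin d) ℝ) (t : ℝ) (x : E d) : Measure (E d) :=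
  multivariateGaussian (Matrix.toEuclideanCLM (𝕜 := ℝ) (NormedSpace.exp (t • B)) x) (covMat Q B t)

/-- The Ornstein-Uhlenbeck semigroup `P_t f(x) = 𝔼_x f(X_t)`. -/
def semigroup (Q B : Matrix (Fin d) (Fin d) ℝ) (t : ℝ) (f : E d → ℝ) (x : E d) : ℝ :=
  ∫ y, f y ∂(law Q B t x)

/-- `f` belongs to `B_b(ℝ^d)`. -/
def IsBddMeasurable (f : E d → ℝ) : Prop :=
  Measurable f ∧ ∃ C : ℝ, ∀ y, |f y| ≤ C

/-- `μ` is an invariant distribution of the semigroup. -/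
structure IsInvariantDistribution (Q B : Matrix (Fin d) (Fin d) ℝ) (μ : Measure (E d)) : Prop where
  isProbabilityMeasure : IsProbabilityMeasure μ
  invariant : ∀ t : ℝ, 0 ≤ t → ∀ f : E d → ℝ, IsBddMeasurable f →
    ∫ x, semigroup Q B t f x ∂μ = ∫ x, f x ∂μ

/-- `m` is the smooth, everywhere positive Lebesgue density of `μ`. -/
structure IsSmoothDensity (μ : Measure (E d)) (m : E d → ℝ) : Prop where
  contDiff : ContDiff ℝ ∞ m
  pos : ∀ y, 0 < m y
  withDensity : μ = (volume : Measure (E d)).withDensity fun y => ENNReal.ofReal (m y)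

/-- `p` is the (continuous version of the) transition density of `P_t` relative to the measure
`m(y) dy`: `P_t f(x) = ∫ f(y) p(x, y) m(y) dy` for all `x` and all `f ∈ B_b(ℝ^d)`. The continuity
in `y` singles out the value of the density at every point. -/
structure IsTransitionDensity (Q B : Matrix (Fin d) (Fin d) ℝ) (m : E d → ℝ) (t : ℝ)
    (p : E d → E d → ℝ) : Prop where
  continuous : ∀ x, Continuous (p x)
  integrable : ∀ f : E d → ℝ, IsBddMeasurable f → ∀ x, Integrable fun y => f y * p x y * m y
  eq_integral : ∀ f : E d → ℝ, IsBddMeasurable f → ∀ x,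
    semigroup Q B t f x = ∫ y, f y * p x y * m y

/-- `n! = n_1! ⋯ n_d!`. -/
def multiFactorial (n : Fin d → ℕ) : ℕ := ∏ j, (n j).factorial

/-- `∂_{v_1}^{n_1} ⋯ ∂_{v_d}^{n_d} f`, where `∂_v` is the directional derivative along `v`. -/
def iterDirDeriv (v : Fin d → E d) (n : Fin d → ℕ) (f : E d → ℝ) : E d → ℝ :=
  (List.finRange d).foldr (fun j g => (fun h y => lineDeriv ℝ h y (v j))^[n j] g) f

/-- `ϱ`: the smallest eigenvalue of `λ_1 M Q_∞ M^*`, where `λ_1 = min_j λ_j`. -/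
def varrho (Q B M : Matrix (Fin d) (Fin d) ℝ) (lam : Fin d → ℝ) : ℝ :=
  sInf (spectrum ℝ ((⨅ j, lam j) • (M * covMatInf Q B * Mᵀ)))

/-- `N = D M` with `D = diag(√(λ_j / ϱ))`. -/
def normMat (Q B M : Matrix (Fin d) (Fin d) ℝ) (lam : Fin d → ℝ) : Matrix (Fin d) (Fin d) ℝ :=
  Matrix.diagonal (fun j => Real.sqrt (lam j / varrho Q B M lam)) * M

/-- The generating function of the eigenfunctions,
`z ↦ exp(⟨Mx, Dz⟩ - ½ ⟨Q_∞ M^* D z, M^* D z⟩) = exp(⟨DMx, z⟩ - ½ ⟨D M Q_∞ M^* D z, z⟩)`. -/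
def genFun (Q B M : Matrix (Fin d) (Fin d) ℝ) (lam : Fin d → ℝ) (x z : E d) : ℝ :=
  let N := normMat Q B M lam
  Real.exp ((N *ᵥ x.ofLp) ⬝ᵥ z.ofLp -
    (1 / 2) * (((N * covMatInf Q B * Nᵀ) *ᵥ z.ofLp) ⬝ᵥ z.ofLp))

/-- The eigenfunction `ℋ_n`: the polynomial determined by
`∑_n ℋ_n(x) z^n / √(n!) = exp(⟨Mx, Dz⟩ - ½ ⟨Q_∞ M^* D z, M^* D z⟩)`, i.e.
`ℋ_n(x) = (n!)^{-1/2} ∂_z^n` of the right-hand side at `z = 0`. -/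
def eigenfun (Q B M : Matrix (Fin d) (Fin d) ℝ) (lam : Fin d → ℝ) (n : Fin d → ℕ) (x : E d) : ℝ :=
  iterDirDeriv (fun j => EuclideanSpace.single j (1 : ℝ)) n (genFun Q B M lam x) 0 /
    Real.sqrt (multiFactorial n)

/-- The co-eigenfunction `𝒢_n(y) = (-1)^{|n|} (n!)^{-1/2} ∂^n μ(y) / μ(y)`, where `m` is the density
of the invariant distribution and the partial derivatives are those of the coordinates `w = D M y`
(the coordinates that diagonalize the drift), i.e. the `j`-th one is the directional derivative
along `(D M)⁻¹ e_j`. -/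
def coeigenfun (Q B M : Matrix (Fin d) (Fin d) ℝ) (lam : Fin d → ℝ) (m : E d → ℝ)
    (n : Fin d → ℕ) (y : E d) : ℝ :=
  (-1) ^ (∑ j, n j) / Real.sqrt (multiFactorial n) *
    (iterDirDeriv (fun j => WithLp.toLp 2 ((normMat Q B M lam)⁻¹ *ᵥ Pi.single j 1)) n m y / m y)

end OU

end

/-!
The expansion is Mehler's formula, proved here by averaging exponentials over standard Gaussian
vectors. Write `R` for the square root of `Q_∞`, `N = D M`, `A = e^{tB}`, and let `ζ`, `η` be
independent standard Gaussian vectors in `ℝ^d`.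

The invariant distribution is `𝒩(0, Q_∞)`: this is the limit `t → ∞` of the invariance relation for
characteristic functions (`eq_multivariateGaussian_of_isInvariantDistribution`). Its density `m` and
the generating function of the `ℋ_n` are both Gaussian functions, hence averages of exponentials,
`m(y) = c 𝔼 exp (-i ⟨η, R⁻¹ y⟩)` and
`genFun x z = 𝔼 exp (⟨N x, z⟩ + i ⟨ζ, R N^* z⟩)` (`isGaussianMixture_exp`).
Differentiating under the expectation (`IsGaussianMixture.iterDirDeriv`) turns `ℋ_n(x)` and
`𝒢_n(y) m(y)` into expectations of monomials of degree `n`: in affine functions of `ζ` for the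
former, and in linear functions of `η`, with the phase `exp (-i ⟨η, R⁻¹ y⟩)`, for the latter
(`ofReal_eigenfun`, `ofReal_coeigenfun`).

After this the series is the expectation over `(ζ, η)` of the expansion of an exponential.
The absolute values of its terms add up to at most `exp (κ e^{-tλ_min} ‖ζ‖ ‖η‖ + υ ‖η‖)`, where only
`υ` depends on `x` and neither constant depends on `y`. By Fernique's theorem this is integrable
as soon as `e^{-tλ_min}` is below a threshold that depends on `κ` only, which is why one `t₀` serves
all `(x, y)` (`exists_hasSum_gaussian_moments`). The sum is
`c 𝔼 exp (i ⟨R⁻¹(A x - y), η⟩ - ⟨R⁻¹ A R ζ, η⟩)`, a Gaussian integral whose value is given by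
`integral_integral_cexp_stdGaussian`. The Lyapunov relation `Q_t = Q_∞ - A Q_∞ A^*`
(`covMat_add_conj_covMatInf`) identifies it with the density of `𝒩(A x, Q_t)` at `y`
(`integral_integral_eq_gaussDensity`). Division by `m(y)` gives `p_t(x, y)`, because a transition
density that is continuous in `y` is determined everywhere (`IsTransitionDensity.mul_eq`).

The constant `ϱ` only rescales `N`, and the products `ℋ_n 𝒢_n` do not depend on it; what matters is
that it is positive, so that `N` is invertible (`isUnit_det_normMat`).
-/

namespace OU

/-! ### The standard Gaussian measure and Gaussian integrals -/

lemma det_adjoint {V : Type*} [NormedAddCommGroup V] [InnerProductSpace ℝ V]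
    [FiniteDimensional ℝ V] (T : V →L[ℝ] V) :
    LinearMap.det (ContinuousLinearMap.adjoint T : V →ₗ[ℝ] V) = LinearMap.det (T : V →ₗ[ℝ] V) := by
  have h := LinearMap.toMatrix_adjoint (stdOrthonormalBasis ℝ V) (stdOrthonormalBasis ℝ V)
    (T : V →ₗ[ℝ] V)
  rw [← LinearMap.det_toMatrix (stdOrthonormalBasis ℝ V).toBasis,
    ← LinearMap.det_toMatrix (stdOrthonormalBasis ℝ V).toBasis (T : V →ₗ[ℝ] V),
    ← Matrix.det_transpose (LinearMap.toMatrix _ _ (T : V →ₗ[ℝ] V)),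
    ← Matrix.conjTranspose_eq_transpose_of_trivial, ← h]
  rfl

section StandardGaussian

open Complex
open scoped RealInnerProductSpace

variable {V : Type*} [NormedAddCommGroup V] [InnerProductSpace ℝ V] [FiniteDimensional ℝ V]
  [MeasurableSpace V] [BorelSpace V]

variable (V) in
/-- The normalizing constant `(2π)^{-dim V / 2}` of the standard Gaussian density, written as an
inverse integral so that no fractional power has to be handled. -/
noncomputable def gaussConst : ℝ := (∫ x : V, Real.exp (-(1 / 2) * ‖x‖ ^ 2))⁻¹

lemma gaussConst_pos : 0 < gaussConst V := by
  rw [gaussConst, GaussianFourier.integral_rexp_neg_mul_sq_norm (by norm_num)]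
  positivity

lemma ofReal_gaussConst :
    (gaussConst V : ℂ) = (∫ x : V, cexp (-(1 / 2 : ℂ) * ‖x‖ ^ 2))⁻¹ := by
  rw [gaussConst, ofReal_inv, ← integral_complex_ofReal]
  simp

lemma gaussConst_mul_integral (c : ℂ) (w : V) :
    (gaussConst V : ℂ) * ∫ x : V, cexp (-(1 / 2 : ℂ) * ‖x‖ ^ 2 + c * ⟪w, x⟫) =
      cexp (c ^ 2 * ‖w‖ ^ 2 / 2) := by
  have hpos : (gaussConst V : ℂ) ≠ 0 := by exact_mod_cast gaussConst_pos.ne'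
  rw [ofReal_gaussConst] at hpos ⊢
  rw [GaussianFourier.integral_cexp_neg_mul_sq_norm_add (by norm_num),
    ← GaussianFourier.integral_cexp_neg_mul_sq_norm (by norm_num), ← mul_assoc,
    inv_mul_cancel₀ (fun h => hpos (by rw [h, inv_zero])), one_mul]
  congr 1
  ring

lemma integrable_exp_neg_half_sq : Integrable fun x : V => Real.exp (-(1 / 2) * ‖x‖ ^ 2) := by
  have h := (GaussianFourier.integrable_cexp_neg_mul_sq_norm_add (V := V) (b := 1 / 2)
    (by norm_num) 0 0).norm
  refine h.congr (ae_of_all _ fun x => ?_)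
  simp [Complex.norm_exp, ← ofReal_pow]

/-- Both sides have the same characteristic function. -/
theorem stdGaussian_eq_withDensity :
    stdGaussian V = (volume : Measure V).withDensity
      fun x => ENNReal.ofReal (gaussConst V * Real.exp (-(1 / 2) * ‖x‖ ^ 2)) := by
  have hint : Integrable fun x : V => gaussConst V * Real.exp (-(1 / 2) * ‖x‖ ^ 2) :=
    integrable_exp_neg_half_sq.const_mul _
  have hnn : ∀ x : V, 0 ≤ gaussConst V * Real.exp (-(1 / 2) * ‖x‖ ^ 2) := fun x => by
    have := gaussConst_pos (V := V); positivity
  have : IsFiniteMeasure ((volume : Measure V).withDensity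
      fun x => ENNReal.ofReal (gaussConst V * Real.exp (-(1 / 2) * ‖x‖ ^ 2))) :=
    isFiniteMeasure_withDensity_ofReal hint.2
  apply Measure.ext_of_charFun
  ext t
  rw [charFun_stdGaussian, charFun_apply, integral_withDensity_eq_integral_toReal_smul
    (by fun_prop) (ae_of_all _ fun x => ENNReal.ofReal_lt_top)]
  have h := gaussConst_mul_integral I t
  rw [I_sq] at h
  rw [show -(‖t‖ : ℂ) ^ 2 / 2 = -1 * (‖t‖ : ℂ) ^ 2 / 2 by ring, ← h, ← integral_const_mul]
  refine integral_congr_ae (ae_of_all _ fun x => ?_)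
  simp only [ENNReal.toReal_ofReal (hnn x), real_smul, ofReal_mul, ofReal_exp]
  rw [mul_assoc, ← Complex.exp_add, real_inner_comm]
  congr 2
  push_cast
  ring

lemma integral_stdGaussian (f : V → ℂ) :
    ∫ x, f x ∂(stdGaussian V) =
      gaussConst V * ∫ x : V, cexp (-(1 / 2 : ℂ) * ‖x‖ ^ 2) * f x := by
  have hnn : ∀ x : V, 0 ≤ gaussConst V * Real.exp (-(1 / 2) * ‖x‖ ^ 2) := fun x => by
    have := gaussConst_pos (V := V); positivity
  rw [stdGaussian_eq_withDensity, integral_withDensity_eq_integral_toReal_smul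
    (by fun_prop) (ae_of_all _ fun x => ENNReal.ofReal_lt_top), ← integral_const_mul]
  refine integral_congr_ae (ae_of_all _ fun x => ?_)
  simp only [ENNReal.toReal_ofReal (hnn x), real_smul]
  push_cast
  ring

/-- The Fourier-Laplace transform of the standard Gaussian in a complex multiple of a real
direction. -/
lemma integral_cexp_mul_inner_stdGaussian (c : ℂ) (w : V) :
    ∫ x, cexp (c * ⟪w, x⟫) ∂(stdGaussian V) = cexp (c ^ 2 * ‖w‖ ^ 2 / 2) := by
  rw [integral_stdGaussian, ← gaussConst_mul_integral]
  simp_rw [← Complex.exp_add]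

lemma map_volume_continuousLinearEquiv (K : V ≃L[ℝ] V) :
    (volume : Measure V).map K =
      ENNReal.ofReal |(LinearMap.det (K : V →ₗ[ℝ] V))⁻¹| • volume := by
  have h := Measure.map_linearMap_addHaar_eq_smul_addHaar (volume : Measure V)
    (f := (K.toLinearEquiv : V →ₗ[ℝ] V)) K.toLinearEquiv.isUnit_det'.ne_zero
  exact h

lemma integral_comp_continuousLinearEquiv (K : V ≃L[ℝ] V) (f : V → ℂ) :
    ∫ x, f (K x) = (|(LinearMap.det (K : V →ₗ[ℝ] V))⁻¹| : ℝ) * ∫ x, f x := by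
  have h := K.toHomeomorph.measurableEmbedding.integral_map (μ := volume) f
  change ∫ x, f x ∂((volume : Measure V).map K) = ∫ x, f (K x) at h
  rw [← h, map_volume_continuousLinearEquiv, integral_smul_measure,
    ENNReal.toReal_ofReal (abs_nonneg _), real_smul]

/-- The Gaussian double integral behind Mehler's formula: the double integral of
`exp (i⟨a, η⟩ - ⟨T ζ, η⟩)` for two independent standard Gaussian vectors `ζ` and `η`,
when `1 - T T^* = K K^*` with `K` invertible. -/
theorem integral_integral_cexp_stdGaussian (T : V →L[ℝ] V) (K : V ≃L[ℝ] V)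
    (hK : ∀ η : V, ‖ContinuousLinearMap.adjoint (K : V →L[ℝ] V) η‖ ^ 2 =
      ‖η‖ ^ 2 - ‖ContinuousLinearMap.adjoint T η‖ ^ 2) (a : V) :
    ∫ η, ∫ ζ, cexp (I * ⟪a, η⟫ - ⟪T ζ, η⟫) ∂(stdGaussian V) ∂(stdGaussian V) =
      (|(LinearMap.det (K : V →ₗ[ℝ] V))⁻¹| * Real.exp (-(1 / 2) * ‖K.symm a‖ ^ 2) : ℝ) := by
  -- the integral over `ζ` is a Laplace transform
  have h1 : ∀ η : V, ∫ ζ, cexp (I * ⟪a, η⟫ - ⟪T ζ, η⟫) ∂(stdGaussian V) =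
      cexp (I * ⟪a, η⟫) * cexp ((‖ContinuousLinearMap.adjoint T η‖ : ℂ) ^ 2 / 2) := by
    intro η
    have h := integral_cexp_mul_inner_stdGaussian (-1) (ContinuousLinearMap.adjoint T η)
    rw [neg_one_sq, one_mul] at h
    rw [← h, ← integral_const_mul]
    refine integral_congr_ae (ae_of_all _ fun ζ => ?_)
    simp only
    rw [← Complex.exp_add, ContinuousLinearMap.adjoint_inner_left, real_inner_comm η (T ζ)]
    congr 1
    ring
  simp_rw [h1]
  rw [integral_stdGaussian]
  have hinv : Function.LeftInverse (ContinuousLinearMap.adjoint (K.symm : V →L[ℝ] V))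
      (ContinuousLinearMap.adjoint (K : V →L[ℝ] V)) := fun x => by
    refine ext_inner_right ℝ fun y => ?_
    simp [ContinuousLinearMap.adjoint_inner_left]
  have hinv' : Function.RightInverse (ContinuousLinearMap.adjoint (K.symm : V →L[ℝ] V))
      (ContinuousLinearMap.adjoint (K : V →L[ℝ] V)) := fun x => by
    refine ext_inner_right ℝ fun y => ?_
    simp [ContinuousLinearMap.adjoint_inner_left]
  -- the change of variables `ξ = K^* η` makes the remaining quadratic form standard
  let K' : V ≃L[ℝ] V := ContinuousLinearEquiv.equivOfInverse
    (ContinuousLinearMap.adjoint (K : V →L[ℝ] V))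
    (ContinuousLinearMap.adjoint (K.symm : V →L[ℝ] V)) hinv hinv'
  have hdet : LinearMap.det (K' : V →ₗ[ℝ] V) = LinearMap.det (K : V →ₗ[ℝ] V) :=
    det_adjoint (K : V →L[ℝ] V)
  have h2 : ∀ η : V, cexp (-(1 / 2 : ℂ) * ‖η‖ ^ 2) *
      (cexp (I * ⟪a, η⟫) * cexp ((‖ContinuousLinearMap.adjoint T η‖ : ℂ) ^ 2 / 2)) =
      (fun ξ : V => cexp (-(1 / 2 : ℂ) * ‖ξ‖ ^ 2 + I * ⟪K.symm a, ξ⟫)) (K' η) := by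
    intro η
    have e1 : ⟪K.symm a, K' η⟫ = ⟪a, η⟫ := by
      change ⟪K.symm a, ContinuousLinearMap.adjoint (K : V →L[ℝ] V) η⟫ = _
      rw [ContinuousLinearMap.adjoint_inner_right]
      simp
    have e2 : (‖K' η‖ : ℂ) ^ 2 = ‖η‖ ^ 2 - ‖ContinuousLinearMap.adjoint T η‖ ^ 2 := by
      exact_mod_cast hK η
    simp only
    rw [← Complex.exp_add, ← Complex.exp_add, e1, e2]
    congr 1
    ring
  rw [integral_congr_ae (ae_of_all _ h2), integral_comp_continuousLinearEquiv K'
    fun ξ => cexp (-(1 / 2 : ℂ) * ‖ξ‖ ^ 2 + I * ⟪K.symm a, ξ⟫), hdet,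
    mul_left_comm, gaussConst_mul_integral, I_sq]
  push_cast
  congr 2
  ring

end StandardGaussian

/-! ### Functions of polynomial growth -/

section PolyGrowth

open Complex
open scoped RealInnerProductSpace

variable {V : Type*} [NormedAddCommGroup V]

/-- Continuous complex-valued functions of at most polynomial growth. -/
def PolyGrowth (P : V → ℂ) : Prop :=
  Continuous P ∧ ∃ (C : ℝ) (k : ℕ), ∀ ξ, ‖P ξ‖ ≤ C * (1 + ‖ξ‖) ^ k

namespace PolyGrowth

lemma const (a : ℂ) : PolyGrowth fun _ : V => a :=
  ⟨continuous_const, ‖a‖, 0, fun ξ => by simp⟩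

lemma mul {P R : V → ℂ} (hP : PolyGrowth P) (hR : PolyGrowth R) :
    PolyGrowth fun ξ => P ξ * R ξ := by
  obtain ⟨hPc, C, k, hC⟩ := hP
  obtain ⟨hRc, C', k', hC'⟩ := hR
  refine ⟨hPc.mul hRc, C * C', k + k', fun ξ => ?_⟩
  calc ‖P ξ * R ξ‖ = ‖P ξ‖ * ‖R ξ‖ := norm_mul _ _
    _ ≤ (C * (1 + ‖ξ‖) ^ k) * (C' * (1 + ‖ξ‖) ^ k') :=
        mul_le_mul (hC ξ) (hC' ξ) (norm_nonneg _) ((norm_nonneg _).trans (hC ξ))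
    _ = C * C' * (1 + ‖ξ‖) ^ (k + k') := by ring

lemma pow {P : V → ℂ} (hP : PolyGrowth P) (n : ℕ) : PolyGrowth fun ξ => P ξ ^ n := by
  induction n with
  | zero => simpa using const 1
  | succ n ih => simpa [pow_succ] using ih.mul hP

lemma list_prod {ι : Type*} (l : List ι) {P : ι → V → ℂ} (hP : ∀ i, PolyGrowth (P i)) :
    PolyGrowth fun ξ => (l.map fun i => P i ξ).prod := by
  induction l with
  | nil => simpa using const 1
  | cons a l ih => simpa using (hP a).mul ih

variable [InnerProductSpace ℝ V]

lemma affine (c : ℂ) (v : V) : PolyGrowth fun ξ => c + I * (⟪v, ξ⟫ : ℂ) := by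
  refine ⟨by fun_prop, ‖c‖ + ‖v‖, 1, fun ξ => ?_⟩
  have h1 : ‖I * (⟪v, ξ⟫ : ℂ)‖ ≤ ‖v‖ * ‖ξ‖ := by
    simpa using abs_real_inner_le_norm v ξ
  have h2 := norm_add_le c (I * (⟪v, ξ⟫ : ℂ))
  nlinarith [norm_nonneg c, norm_nonneg v, norm_nonneg ξ,
    mul_nonneg (norm_nonneg c) (norm_nonneg ξ)]

variable [FiniteDimensional ℝ V] [MeasurableSpace V] [BorelSpace V]

lemma integrable {P : V → ℂ} (hP : PolyGrowth P) : Integrable P (stdGaussian V) := by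
  obtain ⟨hPc, C, k, hC⟩ := hP
  have h0 : MemLp (fun ξ : V => ‖ξ‖) k (stdGaussian V) :=
    (IsGaussian.memLp_id (stdGaussian V) k (ENNReal.natCast_ne_top k)).norm
  have h1 : MemLp (fun ξ : V => 1 + ‖ξ‖) k (stdGaussian V) := (memLp_const (1 : ℝ)).add h0
  have h2 : Integrable (fun ξ : V => C * (1 + ‖ξ‖) ^ k) (stdGaussian V) := by
    refine (h1.integrable_norm_pow'.congr (ae_of_all _ fun ξ => ?_)).const_mul C
    simp only [Real.norm_eq_abs]
    rw [abs_of_nonneg (by positivity)]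
  exact h2.mono' hPc.aestronglyMeasurable (ae_of_all _ hC)

end PolyGrowth

end PolyGrowth

/-! ### Gaussian mixtures of exponentials and their derivatives -/

section Derivatives

open Complex
open scoped RealInnerProductSpace

variable {V : Type*} [NormedAddCommGroup V] [InnerProductSpace ℝ V] [FiniteDimensional ℝ V]
  [MeasurableSpace V] [BorelSpace V]

/-- `f` is the Gaussian superposition of the exponentials `y ↦ exp (⟨p, y⟩ + i ⟨C y, ξ⟩)` with
weights `P ξ`, where `ξ` is a standard Gaussian vector. -/
def IsGaussianMixture (p : V) (C : V →L[ℝ] V) (P : V → ℂ) (f : V → ℝ) : Prop :=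
  ∀ y, (f y : ℂ) = ∫ ξ, P ξ * cexp (⟪p, y⟫ + I * ⟪C y, ξ⟫) ∂(stdGaussian V)

/-- Differentiating a Gaussian mixture along `v` multiplies the weight by the affine form
`⟨p, v⟩ + i ⟨C v, ξ⟩`. -/
lemma IsGaussianMixture.lineDeriv {p : V} {C : V →L[ℝ] V} {P : V → ℂ} {f : V → ℝ}
    (hf : IsGaussianMixture p C P f) (hP : PolyGrowth P) (v : V) :
    IsGaussianMixture p C (fun ξ => P ξ * ((⟪p, v⟫ : ℂ) + I * ⟪C v, ξ⟫))
      (fun y => lineDeriv ℝ f y v) := by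
  intro y
  set ℓ : V → ℂ := fun ξ => (⟪p, v⟫ : ℂ) + I * ⟪C v, ξ⟫ with hℓ
  have hPℓ : PolyGrowth fun ξ => P ξ * ℓ ξ := hP.mul (PolyGrowth.affine _ _)
  have hnorm : ∀ (R : V → ℂ) (s : ℝ) (ξ : V), |s| < 1 →
      ‖R ξ * cexp (⟪p, y + s • v⟫ + I * ⟪C (y + s • v), ξ⟫)‖ ≤
        ‖R ξ‖ * Real.exp (‖p‖ * (‖y‖ + ‖v‖)) := by
    intro R s ξ hs
    rw [norm_mul, Complex.norm_exp]
    gcongr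
    have : (⟪p, y + s • v⟫ + I * ⟪C (y + s • v), ξ⟫ : ℂ).re = ⟪p, y + s • v⟫ := by simp
    rw [this]
    refine (real_inner_le_norm _ _).trans ?_
    gcongr
    refine (norm_add_le _ _).trans ?_
    gcongr
    rw [norm_smul, Real.norm_eq_abs]
    exact mul_le_of_le_one_left (norm_nonneg _) hs.le
  have hcont : ∀ (R : V → ℂ) (s : ℝ), Continuous R →
      AEStronglyMeasurable (fun ξ => R ξ * cexp (⟪p, y + s • v⟫ + I * ⟪C (y + s • v), ξ⟫))
        (stdGaussian V) := fun R s hR => by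
    refine Continuous.aestronglyMeasurable ?_
    fun_prop
  have key := hasDerivAt_integral_of_dominated_loc_of_deriv_le (μ := stdGaussian V) (𝕜 := ℝ)
    (F := fun s ξ => P ξ * cexp (⟪p, y + s • v⟫ + I * ⟪C (y + s • v), ξ⟫))
    (F' := fun s ξ => (P ξ * ℓ ξ) * cexp (⟪p, y + s • v⟫ + I * ⟪C (y + s • v), ξ⟫))
    (x₀ := 0) (s := Metric.ball 0 1)
    (bound := fun ξ => ‖P ξ * ℓ ξ‖ * Real.exp (‖p‖ * (‖y‖ + ‖v‖)))
    (Metric.ball_mem_nhds _ one_pos)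
    (Filter.Eventually.of_forall fun s => hcont P s hP.1)
    ((hP.integrable.norm.mul_const _).mono' (hcont P 0 hP.1)
      (ae_of_all _ fun ξ => hnorm P 0 ξ (by simp)))
    (hcont _ 0 hPℓ.1)
    (ae_of_all _ fun ξ s hs => hnorm (fun ξ => P ξ * ℓ ξ) s ξ (by simpa using hs))
    (hPℓ.integrable.norm.mul_const _)
    (ae_of_all _ fun ξ s _ => ?_)
  · obtain ⟨-, hd⟩ := key
    have hd' : HasDerivAt (fun s : ℝ => (f (y + s • v) : ℂ)) _ 0 :=
      hd.congr_of_eventuallyEq (Filter.Eventually.of_forall fun s => hf (y + s • v))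
    -- `f` is real-valued, so its derivative is the real part of that of its complex lift, and the
    -- two derivatives of the lift agree
    have hre := (Complex.reCLM.hasFDerivAt.comp_hasDerivAt (0 : ℝ) hd')
    have hreal : HasDerivAt (fun s : ℝ => f (y + s • v)) _ 0 := hre
    have heq := hreal.ofReal_comp.unique hd'
    change ((deriv (fun s : ℝ => f (y + s • v)) 0 : ℝ) : ℂ) = _
    rw [hreal.deriv, heq]
    simp [hℓ]
  · have h1 : ∀ s : ℝ, ((⟪p, y + s • v⟫ : ℝ) + I * (⟪C (y + s • v), ξ⟫ : ℝ) : ℂ) =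
        ((⟪p, y⟫ : ℝ) + I * (⟪C y, ξ⟫ : ℝ)) + s * ℓ ξ := by
      intro s
      simp only [hℓ, inner_add_right, inner_add_left, map_add, map_smul, real_inner_smul_left,
        real_inner_smul_right]
      push_cast
      ring
    simp_rw [h1]
    have h2 : HasDerivAt (fun s : ℝ => ((⟪p, y⟫ : ℝ) + I * (⟪C y, ξ⟫ : ℝ) : ℂ) + s * ℓ ξ)
        (1 * ℓ ξ) s := ((Complex.ofRealCLM.hasDerivAt (x := s)).mul_const (ℓ ξ)).const_add _
    have h3 := (h2.cexp).const_mul (P ξ)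
    rwa [one_mul, mul_comm (cexp _), ← mul_assoc] at h3

lemma IsGaussianMixture.iterate_lineDeriv {p : V} {C : V →L[ℝ] V} {P : V → ℂ} {f : V → ℝ}
    (hf : IsGaussianMixture p C P f) (hP : PolyGrowth P) (v : V) (n : ℕ) :
    IsGaussianMixture p C (fun ξ => P ξ * ((⟪p, v⟫ : ℂ) + I * ⟪C v, ξ⟫) ^ n)
      ((fun h y => _root_.lineDeriv ℝ h y v)^[n] f) := by
  induction n with
  | zero => simpa using hf
  | succ n ih =>
    rw [Function.iterate_succ_apply']
    simpa only [pow_succ, ← mul_assoc] using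
      ih.lineDeriv (hP.mul ((PolyGrowth.affine _ _).pow n)) v

/-- Iterated directional derivatives of a Gaussian mixture: each direction contributes a power
of its affine form to the weight. -/
lemma IsGaussianMixture.iterDirDeriv {d : ℕ} {p : E d} {C : E d →L[ℝ] E d} {P : E d → ℂ}
    {f : E d → ℝ} (hf : IsGaussianMixture p C P f) (hP : PolyGrowth P) (v : Fin d → E d)
    (n : Fin d → ℕ) :
    IsGaussianMixture p C (fun ξ => P ξ * ∏ j, ((⟪p, v j⟫ : ℂ) + I * ⟪C (v j), ξ⟫) ^ n j)
      (iterDirDeriv v n f) := by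
  have key : ∀ l : List (Fin d), IsGaussianMixture p C
      (fun ξ => P ξ * (l.map fun j => ((⟪p, v j⟫ : ℂ) + I * ⟪C (v j), ξ⟫) ^ n j).prod)
      (l.foldr (fun j g => (fun h y => _root_.lineDeriv ℝ h y (v j))^[n j] g) f) := by
    intro l
    induction l with
    | nil => simpa using hf
    | cons a l ih =>
      have h := ih.iterate_lineDeriv (hP.mul (PolyGrowth.list_prod l
        (P := fun j ξ => ((⟪p, v j⟫ : ℂ) + I * ⟪C (v j), ξ⟫) ^ n j)
        fun j => (PolyGrowth.affine _ _).pow _)) (v a) (n a)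
      intro y
      refine (h y).trans (integral_congr_ae (ae_of_all _ fun ξ => ?_))
      simp only [List.map_cons, List.prod_cons]
      ring
  have h := key (List.finRange d)
  simp only [← Fin.prod_univ_def] at h
  exact h

/-- The Hubbard-Stratonovich representation of a Gaussian function as a mixture of exponentials
with a constant weight. -/
lemma isGaussianMixture_exp (p : V) (C : V →L[ℝ] V) (c : ℝ) :
    IsGaussianMixture p C (fun _ => c)
      (fun y => c * Real.exp (⟪p, y⟫ - (1 / 2) * ‖C y‖ ^ 2)) := by
  intro y
  have h := integral_cexp_mul_inner_stdGaussian I (C y)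
  simp only [Complex.exp_add]
  rw [integral_const_mul, integral_const_mul, h, I_sq, ← Complex.exp_add]
  push_cast
  congr 2
  ring

end Derivatives

/-! ### Summation of Gaussian moments -/

section Series

open Complex
open scoped RealInnerProductSpace

/-- The multinomial expansion of a product of absolutely convergent series. -/
lemma hasSum_prod_pi {𝕜 : Type*} [RCLike 𝕜] {d : ℕ} (f : Fin d → ℕ → 𝕜) (s : Fin d → 𝕜)
    (hf : ∀ j, HasSum (f j) (s j)) (hfn : ∀ j, Summable fun n => ‖f j n‖) :
    HasSum (fun n : Fin d → ℕ => ∏ j, f j (n j)) (∏ j, s j) := by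
  have key : Summable (fun n : Fin d → ℕ => ‖∏ j, f j (n j)‖) ∧
      HasSum (fun n : Fin d → ℕ => ∏ j, f j (n j)) (∏ j, s j) := by
    induction d with
    | zero =>
      exact ⟨(hasSum_unique _).summable,
        by simp⟩
    | succ d ih =>
      obtain ⟨h1, h2⟩ := ih (fun j => f j.succ) (fun j => s j.succ) (fun j => hf _) fun j => hfn _
      have h3 := summable_mul_of_summable_norm (hfn 0) h1
      have h4 := (hf 0).mul h2 h3
      have h5 := (hfn 0).mul_norm h1
      refine ⟨(Equiv.summable_iff (Fin.consEquiv fun _ : Fin (d + 1) => ℕ)).1 ?_,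
        (Equiv.hasSum_iff (Fin.consEquiv fun _ : Fin (d + 1) => ℕ)).1 ?_⟩
      · simpa [Function.comp_def, Fin.prod_univ_succ, Fin.consEquiv] using h5
      · simpa [Function.comp_def, Fin.prod_univ_succ, Fin.consEquiv] using h4
  exact key.2

lemma hasSum_prod_pow_div_factorial {d : ℕ} (z : Fin d → ℂ) :
    HasSum (fun n : Fin d → ℕ => ∏ j, z j ^ n j / (n j).factorial) (cexp (∑ j, z j)) := by
  rw [Complex.exp_sum]
  refine hasSum_prod_pi (fun j k => z j ^ k / k.factorial) _ (fun j => ?_) fun j => ?_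
  · rw [Complex.exp_eq_exp_ℂ]
    exact NormedSpace.expSeries_div_hasSum_exp (z j)
  · exact NormedSpace.norm_expSeries_div_summable (z j)

lemma hasSum_prod_pow_div_factorial_real {d : ℕ} (z : Fin d → ℝ) :
    HasSum (fun n : Fin d → ℕ => ∏ j, z j ^ n j / (n j).factorial) (Real.exp (∑ j, z j)) := by
  have h := hasSum_prod_pow_div_factorial fun j => (z j : ℂ)
  rw [← Complex.hasSum_ofReal]
  simpa using h

variable {V : Type*} [NormedAddCommGroup V] [InnerProductSpace ℝ V] [FiniteDimensional ℝ V]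
  [MeasurableSpace V] [BorelSpace V]

/-- Summation under the Gaussian integrals. The threshold on the weights `r j` depends on the
directions `α j` and `β j` only, not on the affine parts `u` and `w`. -/
theorem exists_hasSum_gaussian_moments {d : ℕ} (α β : Fin d → V) :
    ∃ ρ : ℝ, 0 < ρ ∧ ∀ (r u : Fin d → ℝ) (w : V), (∀ j, |r j| ≤ ρ) →
      HasSum (fun n : Fin d → ℕ => (∏ j, (r j : ℂ) ^ n j / (n j).factorial) *
        (∫ ζ, ∏ j, ((u j : ℂ) + I * ⟪α j, ζ⟫) ^ n j ∂(stdGaussian V)) *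
        ∫ η, (∏ j, (I * (⟪β j, η⟫ : ℂ)) ^ n j) * cexp (-(I * ⟪w, η⟫)) ∂(stdGaussian V))
      (∫ η, ∫ ζ, cexp (∑ j, r j * ((u j : ℂ) + I * ⟪α j, ζ⟫) * (I * ⟪β j, η⟫) - I * ⟪w, η⟫)
        ∂(stdGaussian V) ∂(stdGaussian V)) := by
  obtain ⟨c, hc, hci⟩ := IsGaussian.exists_integrable_exp_sq (stdGaussian V)
  set κ : ℝ := ∑ j, ‖α j‖ * ‖β j‖ with hκ
  have hκ0 : 0 ≤ κ := Finset.sum_nonneg fun j _ => by positivity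
  -- `c / (κ + 1)` makes the bilinear part at most `c ‖ζ‖ ‖η‖`, and `κ + 1` avoids division by `0`
  refine ⟨min 1 (c / (κ + 1)), lt_min one_pos (by positivity), fun r u w hr => ?_⟩
  have hr1 : ∀ j, |r j| ≤ 1 := fun j => (hr j).trans (min_le_left _ _)
  have hr2 : ∀ j, |r j| ≤ c / (κ + 1) := fun j => (hr j).trans (min_le_right _ _)
  set υ : ℝ := ∑ j, |u j| * ‖β j‖ with hυ
  set γ := stdGaussian V
  let A : Fin d → V × V → ℂ := fun j p => r j * ((u j : ℂ) + I * ⟪α j, p.2⟫) * (I * ⟪β j, p.1⟫)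
  let F : (Fin d → ℕ) → V × V → ℂ := fun n p =>
    (∏ j, A j p ^ n j / (n j).factorial) * cexp (-(I * ⟪w, p.1⟫))
  have hA : ∀ j, Continuous (A j) := fun j => by fun_prop
  have hFc : ∀ n, Continuous (F n) := fun n => by
    have : Continuous fun p => ∏ j, A j p ^ n j / (n j).factorial :=
      continuous_finsetProd _ fun j _ => ((hA j).pow _).div_const _
    fun_prop
  have hphase : ∀ x : ℝ, ‖cexp (-(I * x))‖ = 1 := fun x => by
    rw [Complex.norm_exp]; simp
  have hFnorm : ∀ n p, ‖F n p‖ = ∏ j, ‖A j p‖ ^ n j / (n j).factorial := fun n p => by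
    simp [F, hphase]
  -- the exponent is bilinear in `(ζ, η)` up to a linear term; both parts are absorbed into squares
  have hbound : ∀ p, ∑ j, ‖A j p‖ ≤ υ ^ 2 / (2 * c) + c * ‖p.1‖ ^ 2 + c * ‖p.2‖ ^ 2 := by
    intro p
    have h1 : ∀ j, ‖A j p‖ ≤ |u j| * ‖β j‖ * ‖p.1‖ +
        c / (κ + 1) * (‖α j‖ * ‖β j‖) * (‖p.1‖ * ‖p.2‖) := by
      intro j
      have e1 : ‖A j p‖ = |r j| * ‖(u j : ℂ) + I * ⟪α j, p.2⟫‖ * |⟪β j, p.1⟫| := by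
        simp [A]
      have e2 : ‖(u j : ℂ) + I * ⟪α j, p.2⟫‖ ≤ |u j| + ‖α j‖ * ‖p.2‖ := by
        refine (norm_add_le _ _).trans ?_
        simpa using abs_real_inner_le_norm (α j) p.2
      have e3 := abs_real_inner_le_norm (β j) p.1
      calc ‖A j p‖ ≤ |r j| * (|u j| + ‖α j‖ * ‖p.2‖) * (‖β j‖ * ‖p.1‖) := by rw [e1]; gcongr
        _ = |r j| * (|u j| * ‖β j‖ * ‖p.1‖) + |r j| * (‖α j‖ * ‖β j‖ * (‖p.1‖ * ‖p.2‖)) := by ring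
        _ ≤ 1 * (|u j| * ‖β j‖ * ‖p.1‖) + c / (κ + 1) * (‖α j‖ * ‖β j‖ * (‖p.1‖ * ‖p.2‖)) := by
          gcongr
          · exact hr1 j
          · exact hr2 j
        _ = _ := by ring
    have h2 : ∑ j, ‖A j p‖ ≤ υ * ‖p.1‖ + c / (κ + 1) * κ * (‖p.1‖ * ‖p.2‖) := by
      refine (Finset.sum_le_sum fun j _ => h1 j).trans_eq ?_
      rw [Finset.sum_add_distrib, ← Finset.sum_mul, ← Finset.sum_mul, ← Finset.mul_sum]
    have h3 : c / (κ + 1) * κ ≤ c := by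
      rw [div_mul_eq_mul_div, div_le_iff₀ (by positivity)]
      nlinarith
    have h4 : υ * ‖p.1‖ ≤ υ ^ 2 / (2 * c) + c / 2 * ‖p.1‖ ^ 2 := by
      have : υ ^ 2 / (2 * c) + c / 2 * ‖p.1‖ ^ 2 - υ * ‖p.1‖ =
          (υ - c * ‖p.1‖) ^ 2 / (2 * c) := by field_simp; ring
      have : 0 ≤ (υ - c * ‖p.1‖) ^ 2 / (2 * c) := by positivity
      linarith
    have h5 : c / (κ + 1) * κ * (‖p.1‖ * ‖p.2‖) ≤ c * (‖p.1‖ * ‖p.2‖) := by gcongr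
    nlinarith [mul_nonneg hc.le (sq_nonneg (‖p.1‖ - ‖p.2‖)), mul_nonneg hc.le (sq_nonneg ‖p.2‖)]
  have hdom : Integrable (fun p : V × V => Real.exp (∑ j, ‖A j p‖)) (γ.prod γ) := by
    have hi : Integrable (fun p : V × V => Real.exp (υ ^ 2 / (2 * c)) *
        (Real.exp (c * ‖p.1‖ ^ 2) * Real.exp (c * ‖p.2‖ ^ 2))) (γ.prod γ) :=
      (hci.mul_prod hci).const_mul _
    refine hi.mono' (Continuous.aestronglyMeasurable (by fun_prop)) (ae_of_all _ fun p => ?_)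
    rw [Real.norm_eq_abs, Real.abs_exp, ← Real.exp_add, ← Real.exp_add, ← add_assoc]
    exact Real.exp_le_exp.2 (hbound p)
  have hlim : ∀ p, HasSum (fun n => F n p) (cexp (∑ j, A j p - I * ⟪w, p.1⟫)) := fun p => by
    rw [sub_eq_add_neg, Complex.exp_add]
    exact (hasSum_prod_pow_div_factorial fun j => A j p).mul_right _
  have hsum : ∀ p, HasSum (fun n => ‖F n p‖) (Real.exp (∑ j, ‖A j p‖)) := fun p => by
    simp_rw [hFnorm]
    exact hasSum_prod_pow_div_factorial_real fun j => ‖A j p‖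
  have hmain := hasSum_integral_of_dominated_convergence (μ := γ.prod γ) (F := F)
    (f := fun p => cexp (∑ j, A j p - I * ⟪w, p.1⟫)) (fun n p => ‖F n p‖)
    (fun n => (hFc n).aestronglyMeasurable) (fun n => ae_of_all _ fun p => le_rfl)
    (ae_of_all _ fun p => (hsum p).summable)
    (hdom.congr (ae_of_all _ fun p => (hsum p).tsum_eq.symm)) (ae_of_all _ hlim)
  have hint : Integrable (fun p => cexp (∑ j, A j p - I * ⟪w, p.1⟫)) (γ.prod γ) := by
    refine hdom.mono' (Continuous.aestronglyMeasurable (by fun_prop)) (ae_of_all _ fun p => ?_)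
    rw [sub_eq_add_neg, Complex.exp_add, norm_mul, hphase, mul_one]
    refine (Complex.norm_exp_le_exp_norm _).trans (Real.exp_le_exp.2 (norm_sum_le _ _))
  rw [integral_prod _ hint] at hmain
  refine hmain.congr_fun ?_
  intro n
  have hsplit : ∀ p : V × V, F n p = ((∏ j, (r j : ℂ) ^ n j / (n j).factorial)) *
      (((∏ j, (I * (⟪β j, p.1⟫ : ℂ)) ^ n j) * cexp (-(I * ⟪w, p.1⟫))) *
        ∏ j, ((u j : ℂ) + I * ⟪α j, p.2⟫) ^ n j) := by
    intro p
    simp only [F, A, mul_pow, Finset.prod_div_distrib, Finset.prod_mul_distrib]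
    ring
  simp_rw [hsplit]
  rw [integral_const_mul, integral_prod_mul (fun η : V =>
    (∏ j, (I * (⟪β j, η⟫ : ℂ)) ^ n j) * cexp (-(I * ⟪w, η⟫)))
    (fun ζ : V => ∏ j, ((u j : ℂ) + I * ⟪α j, ζ⟫) ^ n j)]
  ring

end Series

/-! ### Covariance matrices of the Ornstein-Uhlenbeck semigroup -/

section Covariance

variable {d : ℕ}

/-- The integrand `e^{sB} Q e^{sB^*}` of the covariance matrices. -/
noncomputable def covIntegrand (Q B : Matrix (Fin d) (Fin d) ℝ) (s : ℝ) :
    Matrix (Fin d) (Fin d) ℝ :=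
  NormedSpace.exp (s • B) * Q * NormedSpace.exp (s • Bᵀ)

lemma exp_smul_transpose (B : Matrix (Fin d) (Fin d) ℝ) (s : ℝ) :
    NormedSpace.exp (s • Bᵀ) = (NormedSpace.exp (s • B))ᵀ := by
  rw [← Matrix.transpose_smul, Matrix.exp_transpose]

lemma covIntegrand_add (Q B : Matrix (Fin d) (Fin d) ℝ) (s t : ℝ) :
    covIntegrand Q B (s + t) =
      NormedSpace.exp (t • B) * covIntegrand Q B s * (NormedSpace.exp (t • B))ᵀ := by
  have h : NormedSpace.exp ((s + t) • B) = NormedSpace.exp (t • B) * NormedSpace.exp (s • B) := by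
    rw [add_comm, add_smul, Matrix.exp_add_of_commute]
    exact ((Commute.refl B).smul_left t).smul_right s
  simp only [covIntegrand, exp_smul_transpose, h, Matrix.transpose_mul, Matrix.mul_assoc]

lemma posSemidef_covIntegrand {Q : Matrix (Fin d) (Fin d) ℝ} (hQ : Q.PosSemidef)
    (B : Matrix (Fin d) (Fin d) ℝ) (s : ℝ) : (covIntegrand Q B s).PosSemidef := by
  rw [covIntegrand, exp_smul_transpose, ← Matrix.conjTranspose_eq_transpose_of_trivial]
  exact hQ.mul_mul_conjTranspose_same _

lemma exp_smul_eq_conj_diagonal {B M : Matrix (Fin d) (Fin d) ℝ} {lam : Fin d → ℝ}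
    (hM : IsUnit M.det) (hB : M * B * M⁻¹ = Matrix.diagonal (fun j => -lam j)) (t : ℝ) :
    NormedSpace.exp (t • B) =
      M⁻¹ * Matrix.diagonal (fun j => Real.exp (-(t * lam j))) * M := by
  have h1 : t • B = M⁻¹ * Matrix.diagonal (fun j => -(t * lam j)) * M := by
    have h2 : Matrix.diagonal (fun j => -(t * lam j)) = t • (M * B * M⁻¹) := by
      rw [hB, ← Matrix.diagonal_smul]
      congr 1
      ext j
      simp
    rw [h2, Matrix.mul_smul, Matrix.smul_mul, Matrix.mul_assoc M,
      Matrix.nonsing_inv_mul_cancel_left _ _ hM,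
      Matrix.mul_assoc, Matrix.nonsing_inv_mul _ hM, Matrix.mul_one]
  rw [h1, Matrix.exp_conj' M _ ((Matrix.isUnit_iff_isUnit_det _).2 hM), Matrix.exp_diagonal]
  congr 3
  ext j
  rw [Pi.coe_exp, Real.exp_eq_exp_ℝ]

/-- Every entry of `e^{sB} Q e^{sB^*}` is a combination of the decaying exponentials
`e^{-(λ_k + λ_l) s}`. -/
lemma covIntegrand_apply {Q B M : Matrix (Fin d) (Fin d) ℝ} {lam : Fin d → ℝ}
    (hM : IsUnit M.det) (hB : M * B * M⁻¹ = Matrix.diagonal (fun j => -lam j))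
    (s : ℝ) (i j : Fin d) :
    covIntegrand Q B s i j = ∑ l, ∑ k, M⁻¹ i k * (M * Q * Mᵀ) k l * M⁻¹ j l *
      Real.exp (-(lam k + lam l) * s) := by
  have h : covIntegrand Q B s = M⁻¹ * (Matrix.diagonal (fun j => Real.exp (-(s * lam j))) *
      (M * Q * Mᵀ) * Matrix.diagonal (fun j => Real.exp (-(s * lam j)))) * M⁻¹ᵀ := by
    rw [covIntegrand, exp_smul_transpose, exp_smul_eq_conj_diagonal hM hB]
    simp only [Matrix.transpose_mul, Matrix.diagonal_transpose, Matrix.mul_assoc]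
  rw [h, Matrix.mul_apply]
  refine Finset.sum_congr rfl fun l _ => ?_
  rw [Matrix.mul_apply, Finset.sum_mul]
  refine Finset.sum_congr rfl fun k _ => ?_
  rw [Matrix.mul_diagonal, Matrix.diagonal_mul, Matrix.transpose_apply,
    show -(lam k + lam l) * s = -(s * lam k) + -(s * lam l) by ring, Real.exp_add]
  ring

lemma integrableOn_covIntegrand {Q B M : Matrix (Fin d) (Fin d) ℝ} {lam : Fin d → ℝ}
    (hlam : ∀ j, 0 < lam j) (hM : IsUnit M.det)
    (hB : M * B * M⁻¹ = Matrix.diagonal (fun j => -lam j)) (a : ℝ) (i j : Fin d) :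
    IntegrableOn (fun s => covIntegrand Q B s i j) (Set.Ioi a) := by
  simp_rw [covIntegrand_apply hM hB]
  refine integrable_finsetSum _ fun l _ => integrable_finsetSum _ fun k _ => ?_
  exact (exp_neg_integrableOn_Ioi a (add_pos (hlam k) (hlam l))).const_mul _

lemma of_integral_mul_mul {ν : Measure ℝ} {G : ℝ → Matrix (Fin d) (Fin d) ℝ}
    (hG : ∀ i j, Integrable (fun s => G s i j) ν) (A A' : Matrix (Fin d) (Fin d) ℝ) :
    (Matrix.of fun i j => ∫ s, (A * G s * A') i j ∂ν) =
      A * (Matrix.of fun i j => ∫ s, G s i j ∂ν) * A' := by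
  ext i j
  simp only [Matrix.of_apply, Matrix.mul_apply]
  rw [integral_finsetSum _ fun k _ => (integrable_finsetSum _ fun l _ =>
    (hG l k).const_mul _).mul_const _]
  refine Finset.sum_congr rfl fun k _ => ?_
  rw [integral_mul_const, integral_finsetSum _ fun l _ => (hG l k).const_mul _]
  simp_rw [integral_const_mul]

lemma posSemidef_of_integral {ν : Measure ℝ} {G : ℝ → Matrix (Fin d) (Fin d) ℝ}
    (hG : ∀ i j, Integrable (fun s => G s i j) ν) (hpos : ∀ s, (G s).PosSemidef) :
    (Matrix.of fun i j => ∫ s, G s i j ∂ν).PosSemidef := by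
  refine Matrix.PosSemidef.of_dotProduct_mulVec_nonneg ?_ fun x => ?_
  · ext i j
    simp only [Matrix.conjTranspose_apply, Matrix.of_apply, star_trivial]
    refine integral_congr_ae (ae_of_all _ fun s => ?_)
    simpa using (hpos s).isHermitian.apply i j
  · have h : star x ⬝ᵥ ((Matrix.of fun i j => ∫ s, G s i j ∂ν) *ᵥ x) =
        ∫ s, star x ⬝ᵥ (G s *ᵥ x) ∂ν := by
      simp only [dotProduct, Matrix.mulVec, Matrix.of_apply]
      rw [integral_finsetSum _ fun i _ => (integrable_finsetSum _ fun j _ =>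
        (hG i j).mul_const _).const_mul _]
      refine Finset.sum_congr rfl fun i _ => ?_
      rw [integral_const_mul, integral_finsetSum _ fun j _ => (hG i j).mul_const _]
      simp_rw [integral_mul_const]
    rw [h]
    exact integral_nonneg fun s => (hpos s).dotProduct_mulVec_nonneg x

section

variable {Q B M : Matrix (Fin d) (Fin d) ℝ} {lam : Fin d → ℝ}

lemma posSemidef_covMat (hQ : Q.PosSemidef) (hlam : ∀ j, 0 < lam j) (hM : IsUnit M.det)
    (hB : M * B * M⁻¹ = Matrix.diagonal (fun j => -lam j)) {t : ℝ} (ht : 0 ≤ t) :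
    (covMat Q B t).PosSemidef := by
  have h := posSemidef_of_integral (ν := volume.restrict (Set.Ioc 0 t))
    (fun i j => (integrableOn_covIntegrand hlam hM hB 0 i j).mono_set Set.Ioc_subset_Ioi_self)
    (posSemidef_covIntegrand hQ B)
  simp only [covMat, intervalIntegral.integral_of_le ht]
  exact h

lemma posSemidef_covMatInf (hQ : Q.PosSemidef) (hlam : ∀ j, 0 < lam j) (hM : IsUnit M.det)
    (hB : M * B * M⁻¹ = Matrix.diagonal (fun j => -lam j)) : (covMatInf Q B).PosSemidef :=
  posSemidef_of_integral (integrableOn_covIntegrand hlam hM hB 0) (posSemidef_covIntegrand hQ B)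

/-- The Lyapunov relation `Q_t + e^{tB} Q_∞ e^{tB^*} = Q_∞`. -/
lemma covMat_add_conj_covMatInf (hlam : ∀ j, 0 < lam j) (hM : IsUnit M.det)
    (hB : M * B * M⁻¹ = Matrix.diagonal (fun j => -lam j)) (t : ℝ) :
    covMat Q B t + NormedSpace.exp (t • B) * covMatInf Q B * (NormedSpace.exp (t • B))ᵀ =
      covMatInf Q B := by
  have h := of_integral_mul_mul (integrableOn_covIntegrand (Q := Q) hlam hM hB 0)
    (NormedSpace.exp (t • B)) (NormedSpace.exp (t • B))ᵀ
  change _ = NormedSpace.exp (t • B) * covMatInf Q B * (NormedSpace.exp (t • B))ᵀ at h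
  rw [← h]
  ext i j
  simp_rw [← covIntegrand_add]
  have h2 : ∫ s in Set.Ioi 0, covIntegrand Q B (s + t) i j =
      ∫ s in Set.Ioi t, covIntegrand Q B s i j := by
    have := (measurePreserving_add_right volume t).setIntegral_preimage_emb
      (measurableEmbedding_addRight t) (fun s => covIntegrand Q B s i j) (Set.Ioi t)
    simpa using this
  rw [Matrix.add_apply, Matrix.of_apply, h2]
  exact intervalIntegral.integral_interval_add_Ioi
    (integrableOn_covIntegrand hlam hM hB 0 i j) (integrableOn_covIntegrand hlam hM hB t i j)

lemma posDef_covMat (hQ : Q.PosSemidef) (hdet : ∀ t : ℝ, 0 < t → 0 < (covMat Q B t).det)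
    (hlam : ∀ j, 0 < lam j) (hM : IsUnit M.det)
    (hB : M * B * M⁻¹ = Matrix.diagonal (fun j => -lam j)) {t : ℝ} (ht : 0 < t) :
    (covMat Q B t).PosDef :=
  (posSemidef_covMat hQ hlam hM hB ht.le).posDef_iff_det_ne_zero.2 (hdet t ht).ne'

lemma posDef_covMatInf (hQ : Q.PosSemidef) (hdet : ∀ t : ℝ, 0 < t → 0 < (covMat Q B t).det)
    (hlam : ∀ j, 0 < lam j) (hM : IsUnit M.det)
    (hB : M * B * M⁻¹ = Matrix.diagonal (fun j => -lam j)) : (covMatInf Q B).PosDef := by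
  rw [← covMat_add_conj_covMatInf hlam hM hB 1]
  refine (posDef_covMat hQ hdet hlam hM hB one_pos).add_posSemidef ?_
  rw [← Matrix.conjTranspose_eq_transpose_of_trivial]
  exact (posSemidef_covMatInf hQ hlam hM hB).mul_mul_conjTranspose_same _

open Filter Topology in
lemma tendsto_covMat (hlam : ∀ j, 0 < lam j) (hM : IsUnit M.det)
    (hB : M * B * M⁻¹ = Matrix.diagonal (fun j => -lam j)) :
    Tendsto (covMat Q B) atTop (𝓝 (covMatInf Q B)) := by
  refine tendsto_pi_nhds.2 fun i => tendsto_pi_nhds.2 fun j => ?_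
  exact intervalIntegral_tendsto_integral_Ioi 0 (integrableOn_covIntegrand hlam hM hB 0 i j)
    tendsto_id

open Filter Topology in
lemma tendsto_exp_smul (hlam : ∀ j, 0 < lam j) (hM : IsUnit M.det)
    (hB : M * B * M⁻¹ = Matrix.diagonal (fun j => -lam j)) :
    Tendsto (fun t : ℝ => NormedSpace.exp (t • B)) atTop (𝓝 0) := by
  simp_rw [exp_smul_eq_conj_diagonal hM hB]
  have h : Tendsto (fun t : ℝ => Matrix.diagonal fun j => Real.exp (-(t * lam j))) atTop
      (𝓝 (0 : Matrix (Fin d) (Fin d) ℝ)) := by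
    rw [← Matrix.diagonal_zero]
    refine (Continuous.matrix_diagonal continuous_id).tendsto _ |>.comp
      (tendsto_pi_nhds.2 fun j => ?_)
    exact Real.tendsto_exp_neg_atTop_nhds_zero.comp (tendsto_id.atTop_mul_const (hlam j))
  simpa using (h.const_mul M⁻¹).mul_const M

lemma varrho_pos [Nonempty (Fin d)] (hQ : Q.PosSemidef)
    (hdet : ∀ t : ℝ, 0 < t → 0 < (covMat Q B t).det)
    (hlam : ∀ j, 0 < lam j) (hM : IsUnit M.det)
    (hB : M * B * M⁻¹ = Matrix.diagonal (fun j => -lam j)) : 0 < varrho Q B M lam := by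
  have hmin : 0 < ⨅ j, lam j := by
    obtain ⟨j, hj⟩ := exists_eq_ciInf_of_finite (f := lam)
    exact hj ▸ hlam j
  have hS : ((⨅ j, lam j) • (M * covMatInf Q B * Mᵀ)).PosDef := by
    refine Matrix.PosDef.smul ?_ hmin
    rw [← Matrix.conjTranspose_eq_transpose_of_trivial]
    refine (posDef_covMatInf hQ hdet hlam hM hB).mul_mul_conjTranspose_same ?_
    exact Matrix.vecMul_injective_of_isUnit ((Matrix.isUnit_iff_isUnit_det _).2 hM)
  rw [varrho, hS.isHermitian.spectrum_real_eq_range_eigenvalues]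
  obtain ⟨j, hj⟩ := exists_eq_ciInf_of_finite (f := hS.isHermitian.eigenvalues)
  change 0 < ⨅ j, hS.isHermitian.eigenvalues j
  rw [← hj]
  exact hS.eigenvalues_pos j

/-- `N = D M` is invertible, also in dimension `0`, where `ϱ` takes a junk value. -/
lemma isUnit_det_normMat (hQ : Q.PosSemidef)
    (hdet : ∀ t : ℝ, 0 < t → 0 < (covMat Q B t).det)
    (hlam : ∀ j, 0 < lam j) (hM : IsUnit M.det)
    (hB : M * B * M⁻¹ = Matrix.diagonal (fun j => -lam j)) :
    IsUnit (normMat Q B M lam).det := by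
  rw [normMat, Matrix.det_mul, Matrix.det_diagonal]
  refine IsUnit.mul (isUnit_iff_ne_zero.2 (Finset.prod_ne_zero_iff.2 fun j _ => ?_)) hM
  have : Nonempty (Fin d) := ⟨j⟩
  exact (Real.sqrt_pos.2 (div_pos (hlam j) (varrho_pos hQ hdet hlam hM hB))).ne'

/-- The rescaling `D` commutes with the diagonalized drift. -/
lemma normMat_mul_exp (hM : IsUnit M.det)
    (hB : M * B * M⁻¹ = Matrix.diagonal (fun j => -lam j)) (t : ℝ) :
    normMat Q B M lam * NormedSpace.exp (t • B) =
      Matrix.diagonal (fun j => Real.exp (-(t * lam j))) * normMat Q B M lam := by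
  rw [exp_smul_eq_conj_diagonal hM hB, normMat, Matrix.mul_assoc, Matrix.mul_assoc M⁻¹,
    Matrix.mul_nonsing_inv_cancel_left _ _ hM, ← Matrix.mul_assoc, ← Matrix.mul_assoc,
    Matrix.diagonal_mul_diagonal, Matrix.diagonal_mul_diagonal]
  simp_rw [mul_comm]

end

end Covariance

/-! ### Densities of Gaussian laws -/

section Densities

open scoped RealInnerProductSpace

variable {V : Type*} [NormedAddCommGroup V] [InnerProductSpace ℝ V] [FiniteDimensional ℝ V]
  [MeasurableSpace V] [BorelSpace V]

/-- The Lebesgue density of `a + R ξ` for a standard Gaussian vector `ξ` and an invertible `R`. -/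
noncomputable def gaussDensity (R : V ≃L[ℝ] V) (a y : V) : ℝ :=
  gaussConst V * |(LinearMap.det (R : V →ₗ[ℝ] V))⁻¹| * Real.exp (-(1 / 2) * ‖R.symm (y - a)‖ ^ 2)

lemma gaussDensity_pos (R : V ≃L[ℝ] V) (a y : V) : 0 < gaussDensity R a y := by
  have h1 : LinearMap.det (R : V →ₗ[ℝ] V) ≠ 0 := R.toLinearEquiv.isUnit_det'.ne_zero
  have h2 := gaussConst_pos (V := V)
  have h3 : 0 < |(LinearMap.det (R : V →ₗ[ℝ] V))⁻¹| := abs_pos.2 (inv_ne_zero h1)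
  rw [gaussDensity]
  positivity

lemma contDiff_gaussDensity (R : V ≃L[ℝ] V) (a : V) : ContDiff ℝ ∞ (gaussDensity R a) := by
  have h : ContDiff ℝ ∞ fun y => R.symm (y - a) :=
    R.symm.contDiff.comp (contDiff_id.sub contDiff_const)
  exact contDiff_const.mul (Real.contDiff_exp.comp (contDiff_const.mul (h.norm_sq ℝ)))

theorem map_affine_stdGaussian (R : V ≃L[ℝ] V) (a : V) :
    (stdGaussian V).map (fun x => a + R x) =
      (volume : Measure V).withDensity fun y => ENNReal.ofReal (gaussDensity R a y) := by
  have hf : Measurable fun x => a + R x := by fun_prop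
  have hmap : (volume : Measure V).map (fun x => a + R x) =
      ENNReal.ofReal |(LinearMap.det (R : V →ₗ[ℝ] V))⁻¹| • volume := by
    change (volume : Measure V).map ((fun x => a + x) ∘ R) = _
    rw [← Measure.map_map (by fun_prop) (by fun_prop), map_volume_continuousLinearEquiv,
      Measure.map_smul, map_add_left_eq_self]
  have hmeas : Measurable fun y : V =>
      ENNReal.ofReal (gaussConst V * Real.exp (-(1 / 2) * ‖R.symm (y - a)‖ ^ 2)) := by fun_prop
  ext s hs
  rw [Measure.map_apply hf hs, stdGaussian_eq_withDensity, withDensity_apply _ (hf hs),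
    withDensity_apply _ hs]
  have h1 := setLIntegral_map (μ := (volume : Measure V)) hs hmeas hf
  simp only [add_sub_cancel_left, ContinuousLinearEquiv.symm_apply_apply] at h1
  rw [← h1, hmap, Measure.restrict_smul, lintegral_smul_measure, smul_eq_mul,
    ← lintegral_const_mul _ hmeas]
  refine lintegral_congr fun y => ?_
  rw [← ENNReal.ofReal_mul (abs_nonneg _), gaussDensity]
  congr 1
  ring

end Densities

/-! ### Transition laws and the invariant distribution -/

section Law

open scoped RealInnerProductSpace

variable {d : ℕ}

open scoped MatrixOrder in
/-- The square root of a positive definite matrix, as an invertible operator. -/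
lemma exists_sqrt_equiv {S : Matrix (Fin d) (Fin d) ℝ} (hS : S.PosDef) :
    ∃ R : E d ≃L[ℝ] E d, (∀ a : E d, multivariateGaussian a S =
        (volume : Measure (E d)).withDensity fun y => ENNReal.ofReal (gaussDensity R a y)) ∧
      (∀ x y : E d, ⟪R x, y⟫ = ⟪x, R y⟫) ∧
      ∀ x : E d, R (R x) = Matrix.toEuclideanCLM (𝕜 := ℝ) S x := by
  have hmul : CFC.sqrt S * CFC.sqrt S = S :=
    CFC.sqrt_mul_sqrt_self S (Matrix.nonneg_iff_posSemidef.2 hS.posSemidef)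
  have hdet : IsUnit (CFC.sqrt S).det := by
    have h := (Matrix.isUnit_iff_isUnit_det _).1 hS.isUnit
    rw [← hmul, Matrix.det_mul] at h
    exact isUnit_of_mul_isUnit_left h
  have hsa : IsSelfAdjoint (Matrix.toEuclideanCLM (𝕜 := ℝ) (CFC.sqrt S)) :=
    (CFC.sqrt_nonneg S).isSelfAdjoint.map _
  set T := Matrix.toEuclideanCLM (𝕜 := ℝ) (CFC.sqrt S) with hT
  have h1 : T * Matrix.toEuclideanCLM (𝕜 := ℝ) (CFC.sqrt S)⁻¹ = 1 := by
    rw [hT, ← map_mul, Matrix.mul_nonsing_inv _ hdet, map_one]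
  have h2 : Matrix.toEuclideanCLM (𝕜 := ℝ) (CFC.sqrt S)⁻¹ * T = 1 := by
    rw [hT, ← map_mul, Matrix.nonsing_inv_mul _ hdet, map_one]
  let R : E d ≃L[ℝ] E d := ContinuousLinearEquiv.equivOfInverse T
    (Matrix.toEuclideanCLM (𝕜 := ℝ) (CFC.sqrt S)⁻¹)
    (fun x => DFunLike.congr_fun h2 x) (fun x => DFunLike.congr_fun h1 x)
  refine ⟨R, fun a => ?_, fun x y => ?_, fun x => ?_⟩
  · rw [← map_affine_stdGaussian]
    rfl
  · change ⟪T x, y⟫ = ⟪x, T y⟫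
    rw [← ContinuousLinearMap.adjoint_inner_right, hsa.adjoint_eq]
  · change (T * T) x = _
    rw [hT, ← map_mul, hmul]

lemma inner_toEuclideanCLM_left (A : Matrix (Fin d) (Fin d) ℝ) (x y : E d) :
    ⟪Matrix.toEuclideanCLM (𝕜 := ℝ) A x, y⟫ = ⟪x, Matrix.toEuclideanCLM (𝕜 := ℝ) Aᵀ y⟫ := by
  rw [real_inner_comm, Matrix.inner_toEuclideanCLM, Matrix.inner_toEuclideanCLM,
    Matrix.dotProduct_mulVec, Matrix.mulVec_transpose, dotProduct_comm]

/-- The characteristic function in terms of bounded real test functions. -/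
lemma charFun_re_im {ν : Measure (E d)} [IsFiniteMeasure ν] (ξ : E d) :
    (charFun ν ξ).re = ∫ x, Real.cos ⟪x, ξ⟫ ∂ν ∧ (charFun ν ξ).im = ∫ x, Real.sin ⟪x, ξ⟫ ∂ν := by
  have hint : Integrable (fun x : E d => Complex.exp (⟪x, ξ⟫ * Complex.I)) ν :=
    (integrable_const (1 : ℝ)).mono' (Continuous.aestronglyMeasurable (by fun_prop))
      (ae_of_all _ fun x => by simp [Complex.norm_exp])
  rw [charFun_apply]
  constructor
  · refine (integral_re hint).symm.trans ?_
    simp [Complex.exp_ofReal_mul_I_re]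
  · refine (integral_im hint).symm.trans ?_
    simp [Complex.exp_ofReal_mul_I_im]

variable {Q B M : Matrix (Fin d) (Fin d) ℝ} {lam : Fin d → ℝ}

/-- Invariance on the Fourier side. -/
lemma charFun_invariant {μ : Measure (E d)} (hμ : IsInvariantDistribution Q B μ) {t : ℝ}
    (ht : 0 ≤ t) (hpos : (covMat Q B t).PosSemidef) (ξ : E d) :
    charFun μ ξ = charFun μ (Matrix.toEuclideanCLM (𝕜 := ℝ) (NormedSpace.exp (t • B))ᵀ ξ) *
      Complex.exp (-((ξ.ofLp ⬝ᵥ covMat Q B t *ᵥ ξ.ofLp : ℝ) / 2)) := by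
  have := hμ.isProbabilityMeasure
  have hlaw : ∀ x, charFun (law Q B t x) ξ =
      Complex.exp (⟪x, Matrix.toEuclideanCLM (𝕜 := ℝ) (NormedSpace.exp (t • B))ᵀ ξ⟫ * Complex.I) *
        Complex.exp (-((ξ.ofLp ⬝ᵥ covMat Q B t *ᵥ ξ.ofLp : ℝ) / 2)) := by
    intro x
    rw [law, charFun_multivariateGaussian hpos, real_inner_comm, inner_toEuclideanCLM_left,
      sub_eq_add_neg, Complex.exp_add]
  have hfin : ∀ x, IsFiniteMeasure (law Q B t x) := fun x => by
    unfold law; infer_instance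
  have hint : Integrable (fun x => charFun (law Q B t x) ξ) μ := by
    simp_rw [hlaw]
    refine Integrable.mul_const ?_ _
    exact (integrable_const (1 : ℝ)).mono' (Continuous.aestronglyMeasurable (by fun_prop))
      (ae_of_all _ fun x => by simp [Complex.norm_exp])
  have key : charFun μ ξ = ∫ x, charFun (law Q B t x) ξ ∂μ := by
    apply Complex.ext
    · rw [(charFun_re_im ξ).1]
      refine Eq.trans ?_ (integral_re hint)
      rw [← hμ.invariant t ht (fun x => Real.cos ⟪x, ξ⟫)
        ⟨by fun_prop, 1, fun y => Real.abs_cos_le_one _⟩]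
      exact integral_congr_ae (ae_of_all _ fun x => ((charFun_re_im ξ).1).symm)
    · rw [(charFun_re_im ξ).2]
      refine Eq.trans ?_ (integral_im hint)
      rw [← hμ.invariant t ht (fun x => Real.sin ⟪x, ξ⟫)
        ⟨by fun_prop, 1, fun y => Real.abs_sin_le_one _⟩]
      exact integral_congr_ae (ae_of_all _ fun x => ((charFun_re_im ξ).2).symm)
  rw [key]
  simp_rw [hlaw]
  rw [integral_mul_const, ← charFun_apply]

open Filter Topology in
/-- The invariant distribution is `𝒩(0, Q_∞)`: let `t → ∞` in the invariance relation for the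
characteristic function. -/
theorem eq_multivariateGaussian_of_isInvariantDistribution (hQ : Q.PosSemidef)
    (hlam : ∀ j, 0 < lam j) (hM : IsUnit M.det)
    (hB : M * B * M⁻¹ = Matrix.diagonal (fun j => -lam j))
    {μ : Measure (E d)} (hμ : IsInvariantDistribution Q B μ) :
    μ = multivariateGaussian 0 (covMatInf Q B) := by
  have := hμ.isProbabilityMeasure
  apply Measure.ext_of_charFun
  ext ξ
  have h1 : Tendsto (fun t : ℝ =>
      Matrix.toEuclideanCLM (𝕜 := ℝ) (NormedSpace.exp (t • B))ᵀ ξ) atTop (𝓝 0) := by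
    have hc : Continuous fun A : Matrix (Fin d) (Fin d) ℝ => WithLp.toLp 2 (Aᵀ *ᵥ ξ.ofLp) := by
      fun_prop
    have h := (hc.tendsto 0).comp (tendsto_exp_smul hlam hM hB)
    rwa [Matrix.transpose_zero, Matrix.zero_mulVec, WithLp.toLp_zero] at h
  have h2 : Tendsto (fun t : ℝ => (ξ.ofLp ⬝ᵥ covMat Q B t *ᵥ ξ.ofLp : ℝ)) atTop
      (𝓝 (ξ.ofLp ⬝ᵥ covMatInf Q B *ᵥ ξ.ofLp)) := by
    have hc : Continuous fun A : Matrix (Fin d) (Fin d) ℝ => ξ.ofLp ⬝ᵥ A *ᵥ ξ.ofLp := by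
      fun_prop
    exact (hc.tendsto _).comp (tendsto_covMat hlam hM hB)
  have h3 : Tendsto (fun _ : ℝ => charFun μ ξ) atTop (𝓝 (charFun μ 0 *
      Complex.exp (-((ξ.ofLp ⬝ᵥ covMatInf Q B *ᵥ ξ.ofLp : ℝ) / 2)))) := by
    have hc : Continuous fun s : ℝ => Complex.exp (-((s : ℂ) / 2)) := by fun_prop
    refine (((continuous_charFun.tendsto 0).comp h1).mul ((hc.tendsto _).comp h2)).congr' ?_
    filter_upwards [eventually_ge_atTop 0] with t ht
    exact (charFun_invariant hμ ht (posSemidef_covMat hQ hlam hM hB ht) ξ).symm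
  rw [tendsto_nhds_unique tendsto_const_nhds h3,
    charFun_multivariateGaussian (posSemidef_covMatInf hQ hlam hM hB)]
  simp

end Law

/-! ### Transition densities -/

section TransitionDensity

variable {d : ℕ} {Q B : Matrix (Fin d) (Fin d) ℝ}

lemma semigroup_eq_integral {t : ℝ} {x : E d} {q : E d → ℝ} (hq : Measurable q)
    (hq0 : ∀ y, 0 ≤ q y)
    (hlaw : law Q B t x = volume.withDensity fun y => ENNReal.ofReal (q y)) (f : E d → ℝ) :
    semigroup Q B t f x = ∫ y, f y * q y := by
  rw [semigroup, hlaw, integral_withDensity_eq_integral_toReal_smul (by fun_prop)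
    (ae_of_all _ fun y => ENNReal.ofReal_lt_top)]
  simp_rw [ENNReal.toReal_ofReal (hq0 _), smul_eq_mul, mul_comm]

lemma integrable_density {t : ℝ} {x : E d} {q : E d → ℝ} (hq : Measurable q)
    (hq0 : ∀ y, 0 ≤ q y)
    (hlaw : law Q B t x = volume.withDensity fun y => ENNReal.ofReal (q y)) : Integrable q := by
  refine ⟨hq.aestronglyMeasurable, ?_⟩
  rw [hasFiniteIntegral_iff_ofReal (ae_of_all _ hq0)]
  have h : law Q B t x Set.univ < ⊤ := by
    unfold law; exact measure_lt_top _ _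
  rwa [hlaw, withDensity_apply _ MeasurableSet.univ, Measure.restrict_univ] at h

/-- Dividing the Lebesgue density of the law by `m` gives a transition density relative to `m`. -/
lemma isTransitionDensity_div {t : ℝ} {m : E d → ℝ} {q : E d → E d → ℝ} (hm : Continuous m)
    (hm0 : ∀ y, 0 < m y) (hq : ∀ x, Continuous (q x)) (hq0 : ∀ x y, 0 ≤ q x y)
    (hlaw : ∀ x, law Q B t x = volume.withDensity fun y => ENNReal.ofReal (q x y)) :
    IsTransitionDensity Q B m t fun x y => q x y / m y where
  continuous x := (hq x).div hm fun y => (hm0 y).ne'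
  integrable f hf x := by
    obtain ⟨hfm, C, hC⟩ := hf
    have h := (integrable_density (hq x).measurable (hq0 x) (hlaw x)).bdd_mul
      hfm.aestronglyMeasurable (ae_of_all _ hC)
    refine h.congr (ae_of_all _ fun y => ?_)
    have := (hm0 y).ne'
    field_simp
  eq_integral f _ x := by
    rw [semigroup_eq_integral (hq x).measurable (hq0 x) (hlaw x)]
    refine integral_congr_ae (ae_of_all _ fun y => ?_)
    have := (hm0 y).ne'
    field_simp

/-- Two continuous densities of the same law agree everywhere. -/
lemma IsTransitionDensity.mul_eq {t : ℝ} {m : E d → ℝ} {p : E d → E d → ℝ}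
    (hp : IsTransitionDensity Q B m t p) (hm : Continuous m) {x : E d} {q : E d → ℝ}
    (hq : Continuous q) (hq0 : ∀ y, 0 ≤ q y)
    (hlaw : law Q B t x = volume.withDensity fun y => ENNReal.ofReal (q y)) (y : E d) :
    p x y * m y = q y := by
  have h1 : Integrable fun y => p x y * m y := by
    simpa using hp.integrable (fun _ => 1) ⟨measurable_const, 1, by simp⟩ x
  have h2 := integrable_density hq.measurable hq0 hlaw
  have hae : (fun y => p x y * m y) =ᵐ[volume] q := by
    refine h1.ae_eq_of_forall_setIntegral_eq _ _ h2 fun s hs _ => ?_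
    have hf : IsBddMeasurable (s.indicator fun _ => (1 : ℝ)) :=
      ⟨measurable_const.indicator hs, 1, fun y => by
        by_cases hy : y ∈ s <;> simp [hy]⟩
    have h := hp.eq_integral _ hf x
    rw [semigroup_eq_integral hq.measurable hq0 hlaw] at h
    rw [← integral_indicator hs, ← integral_indicator hs]
    refine Eq.trans ?_ (h.symm.trans ?_) <;>
    · refine integral_congr_ae (ae_of_all _ fun y => ?_)
      by_cases hy : y ∈ s <;> simp [hy]
  have := (Continuous.ae_eq_iff_eq volume ((hp.continuous x).mul hm) hq).1 hae
  exact congr_fun this y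

end TransitionDensity

/-! ### The eigenfunction expansion -/

section Expansion

open Complex
open scoped RealInnerProductSpace

variable {d : ℕ} {Q B M : Matrix (Fin d) (Fin d) ℝ} {lam : Fin d → ℝ}

lemma norm_sq_sqrt_equiv {S : Matrix (Fin d) (Fin d) ℝ} {R : E d ≃L[ℝ] E d}
    (hR : ∀ x y : E d, ⟪R x, y⟫ = ⟪x, R y⟫)
    (hRS : ∀ x : E d, R (R x) = Matrix.toEuclideanCLM (𝕜 := ℝ) S x) (x : E d) :
    ‖R x‖ ^ 2 = ⟪x, Matrix.toEuclideanCLM (𝕜 := ℝ) S x⟫ := by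
  rw [← real_inner_self_eq_norm_sq, hR, hRS]

/-- The integral representation of the eigenfunctions: Gaussian averages of complex monomials. -/
lemma ofReal_eigenfun {R : E d ≃L[ℝ] E d} (hR : ∀ x y : E d, ⟪R x, y⟫ = ⟪x, R y⟫)
    (hRS : ∀ x : E d, R (R x) = Matrix.toEuclideanCLM (𝕜 := ℝ) (covMatInf Q B) x)
    (n : Fin d → ℕ) (x : E d) :
    (eigenfun Q B M lam n x : ℂ) =
      (∫ ζ, ∏ j, ((((normMat Q B M lam) *ᵥ x.ofLp) j : ℂ) +
        I * ⟪R (Matrix.toEuclideanCLM (𝕜 := ℝ) (normMat Q B M lam)ᵀ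
          (EuclideanSpace.single j 1)), ζ⟫) ^ n j ∂(stdGaussian (E d))) /
      Real.sqrt (multiFactorial n) := by
  set N := normMat Q B M lam with hN
  let C : E d →L[ℝ] E d := (R : E d →L[ℝ] E d) ∘L Matrix.toEuclideanCLM (𝕜 := ℝ) Nᵀ
  let p : E d := Matrix.toEuclideanCLM (𝕜 := ℝ) N x
  have hgen : genFun Q B M lam x =
      fun z => 1 * Real.exp (⟪p, z⟫ - (1 / 2) * ‖C z‖ ^ 2) := by
    ext z
    have h1 : ⟪p, z⟫ = (N *ᵥ x.ofLp) ⬝ᵥ z.ofLp := by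
      rw [real_inner_comm, Matrix.inner_toEuclideanCLM, dotProduct_comm]
    have h2 : ‖C z‖ ^ 2 = ((N * covMatInf Q B * Nᵀ) *ᵥ z.ofLp) ⬝ᵥ z.ofLp := by
      change ‖R (Matrix.toEuclideanCLM (𝕜 := ℝ) Nᵀ z)‖ ^ 2 = _
      have h3 : Matrix.toEuclideanCLM (𝕜 := ℝ) (N * covMatInf Q B * Nᵀ) z =
          Matrix.toEuclideanCLM (𝕜 := ℝ) N (Matrix.toEuclideanCLM (𝕜 := ℝ) (covMatInf Q B)
            (Matrix.toEuclideanCLM (𝕜 := ℝ) Nᵀ z)) := by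
        rw [map_mul, map_mul]
        rfl
      rw [norm_sq_sqrt_equiv hR hRS, inner_toEuclideanCLM_left, Matrix.transpose_transpose, ← h3,
        Matrix.inner_toEuclideanCLM, dotProduct_comm]
    rw [h1, h2, one_mul]
    rfl
  have hmix := isGaussianMixture_exp p C 1
  rw [← hgen] at hmix
  have h := hmix.iterDirDeriv (PolyGrowth.const _) (fun j => EuclideanSpace.single j (1 : ℝ)) n 0
  rw [eigenfun, ofReal_div, h]
  congr 1
  refine integral_congr_ae (ae_of_all _ fun ζ => ?_)
  simp [C, p, EuclideanSpace.inner_single_right]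

/-- The integral representation of the co-eigenfunctions. -/
lemma ofReal_coeigenfun (R : E d ≃L[ℝ] E d) (n : Fin d → ℕ) (y : E d) :
    (coeigenfun Q B M lam (gaussDensity R 0) n y : ℂ) =
      (gaussConst (E d) * |(LinearMap.det (R : E d →ₗ[ℝ] E d))⁻¹| / gaussDensity R 0 y : ℝ) *
      (∫ η, (∏ j, (I * (⟪R.symm (WithLp.toLp 2 ((normMat Q B M lam)⁻¹ *ᵥ Pi.single j 1)), η⟫ : ℂ))
        ^ n j) * cexp (-(I * ⟪R.symm y, η⟫)) ∂(stdGaussian (E d))) /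
      Real.sqrt (multiFactorial n) := by
  set v : Fin d → E d := fun j => WithLp.toLp 2 ((normMat Q B M lam)⁻¹ *ᵥ Pi.single j 1) with hv
  set c : ℝ := gaussConst (E d) * |(LinearMap.det (R : E d →ₗ[ℝ] E d))⁻¹| with hc
  let C : E d →L[ℝ] E d := -(R.symm : E d →L[ℝ] E d)
  have hdens : gaussDensity R 0 =
      fun y => c * Real.exp (⟪(0 : E d), y⟫ - (1 / 2) * ‖C y‖ ^ 2) := by
    ext y
    simp [gaussDensity, C, hc]
  have hmix := isGaussianMixture_exp 0 C c
  rw [← hdens] at hmix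
  have h := hmix.iterDirDeriv (PolyGrowth.const _) v n y
  have h2 : (iterDirDeriv v n (gaussDensity R 0) y : ℂ) = (-1) ^ (∑ j, n j) * (c *
      ∫ η, (∏ j, (I * (⟪R.symm (v j), η⟫ : ℂ)) ^ n j) *
        cexp (-(I * ⟪R.symm y, η⟫)) ∂(stdGaussian (E d))) := by
    rw [h, ← integral_const_mul, ← integral_const_mul]
    refine integral_congr_ae (ae_of_all _ fun η => ?_)
    have h3 : ∀ j, ((⟪(0 : E d), v j⟫ : ℂ) + I * ⟪C (v j), η⟫) =
        (-1) * (I * (⟪R.symm (v j), η⟫ : ℂ)) := fun j => by simp [C]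
    have h4 : ((⟪(0 : E d), y⟫ : ℂ) + I * ⟪C y, η⟫) = -(I * ⟪R.symm y, η⟫) := by simp [C]
    simp_rw [h3, h4, mul_pow (-1 : ℂ)]
    rw [Finset.prod_mul_distrib, Finset.prod_pow_eq_pow_sum]
    ring
  rw [coeigenfun, ofReal_mul, ofReal_div (iterDirDeriv _ _ _ _), h2]
  -- the sign in `𝒢_n` cancels the signs `-i` produced by the derivatives
  have h5 : ((-1 : ℂ) ^ (∑ j, n j)) * (-1) ^ (∑ j, n j) = 1 := by
    rw [← mul_pow]; simp
  push_cast
  linear_combination (((Real.sqrt (multiFactorial n) : ℝ) : ℂ)⁻¹ *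
    (c * (∫ η, (∏ j, (I * (⟪R.symm (v j), η⟫ : ℂ)) ^ n j) *
        cexp (-(I * ⟪R.symm y, η⟫)) ∂(stdGaussian (E d))) / gaussDensity R 0 y)) * h5

/-- In the coordinates `N y` the drift `e^{tB}` is diagonal. -/
lemma sum_exp_mul_inner (hN : IsUnit (normMat Q B M lam).det) (hM : IsUnit M.det)
    (hB : M * B * M⁻¹ = Matrix.diagonal (fun j => -lam j)) (R : E d ≃L[ℝ] E d) (t : ℝ)
    (z η : E d) :
    ∑ j, Real.exp (-(t * lam j)) * ((normMat Q B M lam) *ᵥ z.ofLp) j *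
      ⟪R.symm (WithLp.toLp 2 ((normMat Q B M lam)⁻¹ *ᵥ Pi.single j 1)), η⟫ =
    ⟪R.symm (Matrix.toEuclideanCLM (𝕜 := ℝ) (NormedSpace.exp (t • B)) z), η⟫ := by
  set N := normMat Q B M lam
  have h1 : NormedSpace.exp (t • B) =
      N⁻¹ * (Matrix.diagonal (fun j => Real.exp (-(t * lam j))) * N) := by
    rw [← normMat_mul_exp hM hB, Matrix.nonsing_inv_mul_cancel_left _ _ hN]
  have h2 : Matrix.toEuclideanCLM (𝕜 := ℝ) (NormedSpace.exp (t • B)) z =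
      ∑ j, (Real.exp (-(t * lam j)) * (N *ᵥ z.ofLp) j) •
        (WithLp.toLp 2 (N⁻¹ *ᵥ Pi.single j 1) : E d) := by
    ext i
    rw [h1, Matrix.ofLp_toEuclideanCLM, ← Matrix.mulVec_mulVec, ← Matrix.mulVec_mulVec]
    simp only [Matrix.mulVec_single_one, WithLp.ofLp_sum, WithLp.ofLp_smul, Finset.sum_apply,
      Pi.smul_apply, smul_eq_mul, Matrix.col_apply]
    rw [Matrix.mulVec, dotProduct]
    refine Finset.sum_congr rfl fun j _ => ?_
    rw [Matrix.mulVec_diagonal]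
    ring
  rw [h2, map_sum, sum_inner]
  refine Finset.sum_congr rfl fun j _ => ?_
  rw [map_smul, real_inner_smul_left]

/-- The value of the Gaussian double integral obtained by summing the expansion: up to the
normalization of the invariant density, it is the density of `𝒩(e^{tB} x, Q_t)`. -/
lemma integral_integral_eq_gaussDensity {R L : E d ≃L[ℝ] E d}
    (hR : ∀ x y : E d, ⟪R x, y⟫ = ⟪x, R y⟫)
    (hRS : ∀ x : E d, R (R x) = Matrix.toEuclideanCLM (𝕜 := ℝ) (covMatInf Q B) x)
    (hL : ∀ x y : E d, ⟪L x, y⟫ = ⟪x, L y⟫) {t : ℝ}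
    (hLS : ∀ x : E d, L (L x) = Matrix.toEuclideanCLM (𝕜 := ℝ) (covMat Q B t) x)
    (hlyap : covMat Q B t + NormedSpace.exp (t • B) * covMatInf Q B * (NormedSpace.exp (t • B))ᵀ =
      covMatInf Q B) (x y : E d) :
    (gaussConst (E d) * |(LinearMap.det (R : E d →ₗ[ℝ] E d))⁻¹| : ℝ) *
      ∫ η, ∫ ζ, cexp (I *
        ⟪R.symm (Matrix.toEuclideanCLM (𝕜 := ℝ) (NormedSpace.exp (t • B)) x - y), η⟫ -
        ⟪R.symm (Matrix.toEuclideanCLM (𝕜 := ℝ) (NormedSpace.exp (t • B)) (R ζ)), η⟫)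
        ∂(stdGaussian (E d)) ∂(stdGaussian (E d)) =
      (gaussDensity L (Matrix.toEuclideanCLM (𝕜 := ℝ) (NormedSpace.exp (t • B)) x) y : ℝ) := by
  set A := NormedSpace.exp (t • B) with hA
  let T : E d →L[ℝ] E d :=
    (R.symm : E d →L[ℝ] E d) ∘L Matrix.toEuclideanCLM (𝕜 := ℝ) A ∘L (R : E d →L[ℝ] E d)
  let K : E d ≃L[ℝ] E d := L.trans R.symm
  have hRsymm : ∀ x y : E d, ⟪R.symm x, y⟫ = ⟪x, R.symm y⟫ := fun x y => by
    have h := hR (R.symm x) (R.symm y)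
    rw [R.apply_symm_apply, R.apply_symm_apply] at h
    exact h.symm
  have hKadj : ∀ η, ContinuousLinearMap.adjoint (K : E d →L[ℝ] E d) η = L (R.symm η) := fun η => by
    refine ext_inner_left ℝ fun z => ?_
    rw [ContinuousLinearMap.adjoint_inner_right]
    change ⟪R.symm (L z), η⟫ = _
    rw [hRsymm, hL]
  have hTadj : ∀ η, ContinuousLinearMap.adjoint T η =
      R (Matrix.toEuclideanCLM (𝕜 := ℝ) Aᵀ (R.symm η)) := fun η => by
    refine ext_inner_left ℝ fun z => ?_
    rw [ContinuousLinearMap.adjoint_inner_right]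
    change ⟪R.symm (Matrix.toEuclideanCLM (𝕜 := ℝ) A (R z)), η⟫ = _
    rw [hRsymm, inner_toEuclideanCLM_left, hR]
  have hK : ∀ η, ‖ContinuousLinearMap.adjoint (K : E d →L[ℝ] E d) η‖ ^ 2 =
      ‖η‖ ^ 2 - ‖ContinuousLinearMap.adjoint T η‖ ^ 2 := fun η => by
    obtain ⟨ξ, rfl⟩ := R.surjective η
    rw [hKadj, hTadj, R.symm_apply_apply, norm_sq_sqrt_equiv hL hLS, norm_sq_sqrt_equiv hR hRS,
      norm_sq_sqrt_equiv hR hRS, inner_toEuclideanCLM_left, Matrix.transpose_transpose]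
    have h : Matrix.toEuclideanCLM (𝕜 := ℝ) (covMatInf Q B) ξ =
        Matrix.toEuclideanCLM (𝕜 := ℝ) (covMat Q B t) ξ +
        Matrix.toEuclideanCLM (𝕜 := ℝ) A (Matrix.toEuclideanCLM (𝕜 := ℝ) (covMatInf Q B)
          (Matrix.toEuclideanCLM (𝕜 := ℝ) Aᵀ ξ)) := by
      conv_lhs => rw [← hlyap, map_add, map_mul, map_mul]
      rfl
    rw [h, inner_add_right]
    ring
  have key := integral_integral_cexp_stdGaussian T K hK
    (R.symm (Matrix.toEuclideanCLM (𝕜 := ℝ) A x - y))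
  have hsymm : K.symm (R.symm (Matrix.toEuclideanCLM (𝕜 := ℝ) A x - y)) =
      -(L.symm (y - Matrix.toEuclideanCLM (𝕜 := ℝ) A x)) := by
    change L.symm (R (R.symm _)) = _
    rw [R.apply_symm_apply, ← map_neg, neg_sub]
  have hdet : LinearMap.det (R : E d →ₗ[ℝ] E d) * LinearMap.det (K : E d →ₗ[ℝ] E d) =
      LinearMap.det (L : E d →ₗ[ℝ] E d) := by
    rw [← LinearMap.det_comp]
    congr 1
    ext z : 1
    exact R.apply_symm_apply (L z)
  rw [hsymm, norm_neg] at key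
  refine (congrArg _ key).trans ?_
  rw [← ofReal_mul, gaussDensity, ← hdet, mul_inv, abs_mul]
  congr 1
  ring

/-- The eigenfunction expansion, for times at which the factors `e^{-t λ_j}` are small. -/
theorem exists_hasSum_eigenfun_mul_coeigenfun (hN : IsUnit (normMat Q B M lam).det)
    (hM : IsUnit M.det) (hB : M * B * M⁻¹ = Matrix.diagonal (fun j => -lam j))
    {R : E d ≃L[ℝ] E d} (hR : ∀ x y : E d, ⟪R x, y⟫ = ⟪x, R y⟫)
    (hRS : ∀ x : E d, R (R x) = Matrix.toEuclideanCLM (𝕜 := ℝ) (covMatInf Q B) x) :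
    ∃ ρ : ℝ, 0 < ρ ∧ ∀ (t : ℝ) (L : E d ≃L[ℝ] E d), (∀ j, Real.exp (-(t * lam j)) ≤ ρ) →
      (∀ x y : E d, ⟪L x, y⟫ = ⟪x, L y⟫) →
      (∀ x : E d, L (L x) = Matrix.toEuclideanCLM (𝕜 := ℝ) (covMat Q B t) x) →
      covMat Q B t + NormedSpace.exp (t • B) * covMatInf Q B * (NormedSpace.exp (t • B))ᵀ =
        covMatInf Q B →
      ∀ x y : E d, HasSum (fun n : Fin d → ℕ => Real.exp (-t * ∑ j, (n j : ℝ) * lam j) *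
        eigenfun Q B M lam n x * coeigenfun Q B M lam (gaussDensity R 0) n y)
        (gaussDensity L (Matrix.toEuclideanCLM (𝕜 := ℝ) (NormedSpace.exp (t • B)) x) y /
          gaussDensity R 0 y) := by
  set N := normMat Q B M lam with hNdef
  let α : Fin d → E d := fun j =>
    R (Matrix.toEuclideanCLM (𝕜 := ℝ) Nᵀ (EuclideanSpace.single j 1))
  let β : Fin d → E d := fun j => R.symm (WithLp.toLp 2 (N⁻¹ *ᵥ Pi.single j 1))
  obtain ⟨ρ, hρ, hsum⟩ := exists_hasSum_gaussian_moments α β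
  refine ⟨ρ, hρ, fun t L ht hL hLS hlyap x y => ?_⟩
  have h := hsum (fun j => Real.exp (-(t * lam j))) (N *ᵥ x.ofLp) (R.symm y)
    (fun j => by rw [Real.abs_exp]; exact ht j)
  have hα : ∀ j (ζ : E d), ⟪α j, ζ⟫ = (N *ᵥ (R ζ).ofLp) j := fun j ζ => by
    change ⟪R _, ζ⟫ = _
    rw [hR, inner_toEuclideanCLM_left, Matrix.transpose_transpose]
    simp [EuclideanSpace.inner_single_left]
  have hexp : ∀ η ζ : E d, ∑ j, (Real.exp (-(t * lam j)) : ℂ) *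
      (((N *ᵥ x.ofLp) j : ℂ) + I * ⟪α j, ζ⟫) * (I * ⟪β j, η⟫) - I * ⟪R.symm y, η⟫ =
      I * ⟪R.symm (Matrix.toEuclideanCLM (𝕜 := ℝ) (NormedSpace.exp (t • B)) x - y), η⟫ -
        ⟪R.symm (Matrix.toEuclideanCLM (𝕜 := ℝ) (NormedSpace.exp (t • B)) (R ζ)), η⟫ := by
    intro η ζ
    rw [map_sub, inner_sub_left, ← sum_exp_mul_inner hN hM hB R t x η,
      ← sum_exp_mul_inner hN hM hB R t (R ζ) η]
    simp_rw [hα]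
    simp only [ofReal_sub, ofReal_sum, ofReal_mul]
    rw [mul_sub, Finset.mul_sum, sub_right_comm, ← Finset.sum_sub_distrib]
    congr 1
    refine Finset.sum_congr rfl fun j _ => ?_
    linear_combination ((Real.exp (-(t * lam j)) : ℂ) * (N *ᵥ (R ζ).ofLp) j * ⟪β j, η⟫) * I_sq
  simp_rw [hexp] at h
  rw [← Complex.hasSum_ofReal]
  have h2 := h.mul_left
    ((gaussConst (E d) * |(LinearMap.det (R : E d →ₗ[ℝ] E d))⁻¹| : ℝ) : ℂ)
  rw [integral_integral_eq_gaussDensity hR hRS hL hLS hlyap x y] at h2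
  have h3 := h2.div_const (gaussDensity R 0 y : ℂ)
  rw [← ofReal_div] at h3
  refine h3.congr_fun ?_
  intro n
  have hfac : ((Real.sqrt (multiFactorial n) : ℝ) : ℂ) * (Real.sqrt (multiFactorial n) : ℝ) =
      ∏ j, ((n j).factorial : ℂ) := by
    rw [← ofReal_mul, Real.mul_self_sqrt (Nat.cast_nonneg _), multiFactorial]
    push_cast
    rfl
  have hr : ((Real.exp (-t * ∑ j, (n j : ℝ) * lam j) : ℝ) : ℂ) =
      ∏ j, (Real.exp (-(t * lam j)) : ℂ) ^ n j := by
    rw [Finset.mul_sum, Real.exp_sum, ofReal_prod]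
    refine Finset.prod_congr rfl fun j _ => ?_
    rw [← ofReal_pow, ← Real.exp_nat_mul]
    congr 2
    ring
  rw [ofReal_mul, ofReal_mul, ofReal_eigenfun hR hRS, ofReal_coeigenfun, hr,
    Finset.prod_div_distrib, ← hfac]
  push_cast
  ring

end Expansion

end OU

theorem theorem3p6 {d : ℕ} (Q B M : Matrix (Fin d) (Fin d) ℝ) (lam : Fin d → ℝ)
    (hQ : Q.PosSemidef)
    (hdet : ∀ t : ℝ, 0 < t → 0 < (OU.covMat Q B t).det)
    (hlam : ∀ j, 0 < lam j)
    (hM : IsUnit M.det)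
    (hB : M * B * M⁻¹ = Matrix.diagonal (fun j => -lam j))
    (μ : Measure (OU.E d)) (hμ : OU.IsInvariantDistribution Q B μ) :
    ∃ m : OU.E d → ℝ, OU.IsSmoothDensity μ m ∧
      (∀ t : ℝ, 0 < t → ∃ p, OU.IsTransitionDensity Q B m t p) ∧
      ∃ t₀ : ℝ, 0 < t₀ ∧ ∀ t : ℝ, t₀ < t →
        ∀ p, OU.IsTransitionDensity Q B m t p → ∀ x y : OU.E d,
          Summable (fun n : Fin d → ℕ =>
            |Real.exp (-t * ∑ j, (n j : ℝ) * lam j) *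
              OU.eigenfun Q B M lam n x * OU.coeigenfun Q B M lam m n y|) ∧
          p x y = ∑' n : Fin d → ℕ,
            Real.exp (-t * ∑ j, (n j : ℝ) * lam j) *
              OU.eigenfun Q B M lam n x * OU.coeigenfun Q B M lam m n y := by
  obtain ⟨R, hRlaw, hR, hRS⟩ := OU.exists_sqrt_equiv (OU.posDef_covMatInf hQ hdet hlam hM hB)
  have hm := OU.contDiff_gaussDensity R 0
  refine ⟨OU.gaussDensity R 0, ⟨hm, OU.gaussDensity_pos R 0, ?_⟩, fun t ht => ?_, ?_⟩
  · rw [OU.eq_multivariateGaussian_of_isInvariantDistribution hQ hlam hM hB hμ, hRlaw]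
  · obtain ⟨L, hLlaw, -, -⟩ := OU.exists_sqrt_equiv (OU.posDef_covMat hQ hdet hlam hM hB ht)
    exact ⟨_, OU.isTransitionDensity_div hm.continuous (OU.gaussDensity_pos R 0)
      (fun x => (OU.contDiff_gaussDensity L _).continuous)
      (fun x y => (OU.gaussDensity_pos L _ y).le) fun x => hLlaw _⟩
  · obtain ⟨ρ, hρ, hsum⟩ := OU.exists_hasSum_eigenfun_mul_coeigenfun
      (OU.isUnit_det_normMat hQ hdet hlam hM hB) hM hB hR hRS
    have hev : ∀ᶠ t : ℝ in Filter.atTop, ∀ j, Real.exp (-(t * lam j)) ≤ ρ := by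
      refine Filter.eventually_all.2 fun j => ?_
      have h : Filter.Tendsto (fun t : ℝ => Real.exp (-(t * lam j))) Filter.atTop (nhds 0) :=
        Real.tendsto_exp_neg_atTop_nhds_zero.comp
          (Filter.tendsto_id.atTop_mul_const (hlam j))
      exact (h.eventually_lt_const hρ).mono fun t ht => ht.le
    obtain ⟨t₁, ht₁⟩ := Filter.eventually_atTop.1 hev
    refine ⟨max 1 t₁, lt_max_of_lt_left one_pos, fun t ht p hp x y => ?_⟩
    have ht0 : 0 < t := one_pos.trans ((le_max_left _ _).trans_lt ht)
    obtain ⟨L, hLlaw, hL, hLS⟩ := OU.exists_sqrt_equiv (OU.posDef_covMat hQ hdet hlam hM hB ht0)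
    have h := hsum t L (ht₁ t ((le_max_right _ _).trans ht.le)) hL hLS
      (OU.covMat_add_conj_covMatInf hlam hM hB t) x y
    refine ⟨h.summable.abs, ?_⟩
    rw [h.tsum_eq, eq_div_iff (OU.gaussDensity_pos R 0 y).ne']
    exact hp.mul_eq hm.continuous (OU.contDiff_gaussDensity L _).continuous
      (fun y => (OU.gaussDensity_pos L _ y).le) (hLlaw _) y
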